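/- Let $\nu>0$, $\bar u_l>\bar u_r$, $p>0$, and let $w_0\in L^\infty(\mathbb R)$ be $p$-periodic with $\frac1p\int_0^p w_0\,dx=0$. Put $f(u)=u^2/2$ and $s=\frac{f(\bar u_l)-f(\bar u_r)}{\bar u_l-\bar u_r}$. Let $\phi$ be any shock profile with viscosity $1$, i.e. a $C^2$ solution of $\phi''=f'(\phi)\phi'-s\phi'$ on $\mathbb R$ with $\phi(-\infty)=\bar u_l$ and $\phi(+\infty)=\bar u_r$, and set $$\phi^\nu(x)=\phi(x/\nu),\qquad g^\nu(x)=\frac{\phi^\nu(x)-\bar u_r}{\bar u_l-\bar u_r}.$$ By a bounded solution of Burgers' equation $\partial_t u+\partial_x f(u)=\nu\,\partial_x^2u$ ($x\in\mathbb R$, $t>0$) with data $u(\cdot,0)=u_0$ we mean a function that is bounded and smooth for $t>0$, satisfies the equation there, and satisfies $\int_{\mathbb R}[\varphi(x,t)u(x,t)-\varphi(x,0)u_0(x)]\,dx\to0$ as $t\to0^+$ for every continuous compactly supported $\varphi$ on $\mathbb R\times[0,\infty)$. Let $u^\nu,u_l^\nu,u_r^\nu$ be the bounded solutions with data $\phi^\nu+w_0$,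 $\bar u_l+w_0$, $\bar u_r+w_0$ respectively, and for $\xi\in\mathbb R$ let $$\psi^\nu_\xi(x,t)=u_l^\nu(x,t)\,g^\nu(x-\xi)+u_r^\nu(x,t)\,\bigl(1-g^\nu(x-\xi)\bigr).$$ Let $t_k=\dfrac{kp}{\bar u_l-\bar u_r}$, $k=0,1,2,\dots$. Then: 1. For every $k\ge0$ and every $x\in\mathbb R$, $\;u^\nu(x,t_k)=\psi^\nu_{st_k}(x,t_k)$. 2. Let $T_0>0$ be such that $\frac{\bar u_l-\bar u_r}2<u_l^\nu(x,t)-u_r^\nu(x,t)<2(\bar u_l-\bar u_r)$ for all $x\in\mathbb R$, $t\ge T_0$, and let $X^\nu:[T_0,\infty)\to\mathbb R$ be the shift function, i.e. the continuous function that satisfies $\int_{\mathbb R}\bigl(u^\nu-\psi^\nu_{X^\nu(T_0)}\bigr)(x,T_0)\,dx=0$ and, for $t>T_0$, $(X^\nu)'(t)=F^\nu(X^\nu(t),t)$, where $$F^\nu(\xi,t)=\frac{\int_{\mathbb R}\bigl[\nu(u_l^\nu-u_r^\nu)(x,t)\,(g^\nu)''(x-\xi)+\bigl(f(u_l^\nu)-f(u_r^\nu)\bigr)(x,t)\,(g^\nu)'(x-\xi)\bigr]dx}{\int_{\mathbb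 R}(u_l^\nu-u_r^\nu)(x,t)\,(g^\nu)'(x-\xi)\,dx}.$$ Then $X^\nu(t_k)=s\,t_k$ for every $k$ with $t_k\ge T_0$. -/

import Mathlib

open MeasureTheory Filter Topology Set
open scoped ContDiff

namespace ViscousLaw

/-- The Burgers flux `f(u) = u ^ 2 / 2`. -/
noncomputable def burgersFlux (v : ℝ) : ℝ := v ^ 2 / 2

/-- `u` (written `u x t`) is a bounded solution of the Cauchy problem
`∂ₜ u + ∂ₓ f(u) = ν ∂ₓ² u` for `x ∈ ℝ`, `t > 0`, with `u(x, 0) = u₀(x)`: it is smooth and bounded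
for `t > 0`, satisfies the equation pointwise there, and attains the data in the weak sense. -/
structure IsBoundedSolution (f : ℝ → ℝ) (ν : ℝ) (u₀ : ℝ → ℝ) (u : ℝ → ℝ → ℝ) : Prop where
  smooth : ContDiffOn ℝ ∞ (fun z : ℝ × ℝ => u z.1 z.2) {z : ℝ × ℝ | 0 < z.2}
  bounded : ∃ M : ℝ, ∀ x t : ℝ, 0 < t → |u x t| ≤ M
  equation : ∀ x t : ℝ, 0 < t →
    deriv (fun τ => u x τ) t + deriv (fun y => f (u y t)) x
      = ν * iteratedDeriv 2 (fun y => u y t) x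
  initial_value : ∀ x : ℝ, u x 0 = u₀ x
  initial_weak : ∀ η : ℝ × ℝ → ℝ, Continuous η → HasCompactSupport η →
    Tendsto (fun t : ℝ => ∫ x : ℝ, (η (x, t) * u x t - η (x, 0) * u₀ x)) (𝓝[>] 0) (𝓝 0)

/-- The shock speed given by the Rankine-Hugoniot condition. -/
noncomputable def shockSpeed (f : ℝ → ℝ) (ul ur : ℝ) : ℝ := (f ul - f ur) / (ul - ur)

/-- `φ` is a viscous shock profile, for viscosity `ν`, joining `ul` at `-∞` to `ur` at `+∞`. -/
structure IsShockProfile (f : ℝ → ℝ) (ν ul ur : ℝ) (φ : ℝ → ℝ) : Prop where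
  contDiff : ContDiff ℝ 2 φ
  equation : ∀ x : ℝ,
    ν * iteratedDeriv 2 φ x = deriv f (φ x) * deriv φ x - shockSpeed f ul ur * deriv φ x
  limit_left : Tendsto φ atBot (𝓝 ul)
  limit_right : Tendsto φ atTop (𝓝 ur)

/-- `φ^ν(x) = φ(x / ν)`. -/
noncomputable def scaledProfile (φ : ℝ → ℝ) (ν : ℝ) (x : ℝ) : ℝ := φ (x / ν)

/-- `g^ν(x) = (φ^ν(x) - ur) / (ul - ur)`. -/
noncomputable def weight (φ : ℝ → ℝ) (ν ul ur : ℝ) (x : ℝ) : ℝ :=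
  (scaledProfile φ ν x - ur) / (ul - ur)

/-- The ansatz `ψ_ξ(x, t) = u_l(x, t) g(x - ξ) + u_r(x, t) (1 - g(x - ξ))`,
where `ξ` is the value of the shift at time `t`. -/
def ansatz (uL uR : ℝ → ℝ → ℝ) (g : ℝ → ℝ) (ξ x t : ℝ) : ℝ :=
  uL x t * g (x - ξ) + uR x t * (1 - g (x - ξ))

/-- The right-hand side `F(ξ, t)` of the differential equation for the shift. -/
noncomputable def shiftField (f : ℝ → ℝ) (ν : ℝ) (uL uR : ℝ → ℝ → ℝ) (g : ℝ → ℝ)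
    (ξ t : ℝ) : ℝ :=
  (∫ x : ℝ, (ν * (uL x t - uR x t) * iteratedDeriv 2 g (x - ξ)
      + (f (uL x t) - f (uR x t)) * deriv g (x - ξ)))
    / ∫ x : ℝ, (uL x t - uR x t) * deriv g (x - ξ)

/-- `T₀ > 0` is a time from which on `u_l - u_r` stays strictly between half of and twice
`ul - ur`. -/
def IsAdmissibleTime (ul ur : ℝ) (uL uR : ℝ → ℝ → ℝ) (T₀ : ℝ) : Prop :=
  0 < T₀ ∧ ∀ x t : ℝ, T₀ ≤ t →
    (ul - ur) / 2 < uL x t - uR x t ∧ uL x t - uR x t < 2 * (ul - ur)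

/-- `X` is a shift function on `[T₀, ∞)`: it solves `X'(t) = F(X(t), t)` for `t > T₀`, and its
value at `T₀` is such that the difference of `u` and the ansatz has zero mass at `T₀`. -/
structure IsShiftFunction (f : ℝ → ℝ) (ν : ℝ) (u uL uR : ℝ → ℝ → ℝ) (g : ℝ → ℝ)
    (T₀ : ℝ) (X : ℝ → ℝ) : Prop where
  continuousOn : ContinuousOn X (Ici T₀)
  zero_mass : ∫ x : ℝ, (u x T₀ - ansatz uL uR g (X T₀) x T₀) = 0
  equation : ∀ t : ℝ, T₀ < t → HasDerivAt X (shiftField f ν uL uR g (X t) t) t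

end ViscousLaw

/-! The Cole-Hopf transform `exp (-U / (2 * ν))` of a potential `U` of a bounded solution of
Burgers' equation solves the heat equation, whose solutions of at most exponential growth are
determined by their initial values; hence so are the potentials. Since the heat equation is linear
and the shock profile is the sigmoid of the linear gap between the potentials of `ul` and `ur`, `u`
is for all time the convex combination of `uL` and `uR` with weight the sigmoid of
`-(UL - UR) / (2 * ν)`. By Galilean invariance `UL x t` is `UR (x - (ul - ur) * t) t` plus an
affine function, and at the times `t_k` the translation is by `k` periods of the initial
perturbation. There the gap `UL - UR` is affine, the weight is the shock profile itself, and `u` is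
the ansatz centred at `s * t_k`.

For the shift function, the mass of `u - ψ_ξ` is the integral of the periodic part of the gap
against the derivative of the profile. The shift equation says exactly that this mass is conserved
along `X`, hence zero, whereas at time `t_k` it equals `-(ul - ur) * (ξ - s * t_k)`. -/

namespace ViscousLaw

section Slices

variable {f : ℝ → ℝ → ℝ} {s : Set (ℝ × ℝ)}

lemma hasDerivAt_slice_fst {x t : ℝ}
    (hf : DifferentiableAt ℝ (fun z : ℝ × ℝ => f z.1 z.2) (x, t)) :
    HasDerivAt (fun y => f y t) (fderiv ℝ (fun z : ℝ × ℝ => f z.1 z.2) (x, t) (1, 0)) x := by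
  simpa [Function.comp_def] using
    hf.hasFDerivAt.comp_hasDerivAt x ((hasDerivAt_id x).prodMk (hasDerivAt_const x t))

lemma hasDerivAt_slice_snd {x t : ℝ}
    (hf : DifferentiableAt ℝ (fun z : ℝ × ℝ => f z.1 z.2) (x, t)) :
    HasDerivAt (fun τ => f x τ) (fderiv ℝ (fun z : ℝ × ℝ => f z.1 z.2) (x, t) (0, 1)) t := by
  simpa [Function.comp_def] using
    hf.hasFDerivAt.comp_hasDerivAt t ((hasDerivAt_const t x).prodMk (hasDerivAt_id t))

lemma hasDerivAt_deriv_slice_fst (hs : IsOpen s)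
    (hf : ContDiffOn ℝ ∞ (fun z : ℝ × ℝ => f z.1 z.2) s) {x t : ℝ} (h : (x, t) ∈ s) :
    HasDerivAt (fun y => f y t) (deriv (fun y => f y t) x) x :=
  (hasDerivAt_slice_fst ((hf.contDiffAt (hs.mem_nhds h)).differentiableAt
    (by simp))).differentiableAt.hasDerivAt

lemma hasDerivAt_deriv_slice_snd (hs : IsOpen s)
    (hf : ContDiffOn ℝ ∞ (fun z : ℝ × ℝ => f z.1 z.2) s) {x t : ℝ} (h : (x, t) ∈ s) :
    HasDerivAt (fun τ => f x τ) (deriv (fun τ => f x τ) t) t :=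
  (hasDerivAt_slice_snd ((hf.contDiffAt (hs.mem_nhds h)).differentiableAt
    (by simp))).differentiableAt.hasDerivAt

lemma contDiffOn_deriv_slice_fst (hs : IsOpen s)
    (hf : ContDiffOn ℝ ∞ (fun z : ℝ × ℝ => f z.1 z.2) s) :
    ContDiffOn ℝ ∞ (fun z : ℝ × ℝ => deriv (fun y => f y z.2) z.1) s :=
  ((hf.fderiv_of_isOpen hs (by simp)).clm_apply contDiffOn_const).congr fun z hz =>
    (hasDerivAt_slice_fst ((hf.contDiffAt (hs.mem_nhds hz)).differentiableAt (by simp))).deriv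

lemma contDiffOn_deriv_slice_snd (hs : IsOpen s)
    (hf : ContDiffOn ℝ ∞ (fun z : ℝ × ℝ => f z.1 z.2) s) :
    ContDiffOn ℝ ∞ (fun z : ℝ × ℝ => deriv (fun τ => f z.1 τ) z.2) s :=
  ((hf.fderiv_of_isOpen hs (by simp)).clm_apply contDiffOn_const).congr fun z hz =>
    (hasDerivAt_slice_snd ((hf.contDiffAt (hs.mem_nhds hz)).differentiableAt (by simp))).deriv

lemma hasFDerivAt_of_hasDerivAt_slices {f₁ f₂ : ℝ → ℝ → ℝ} (hs : IsOpen s)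
    (h₁ : ∀ z ∈ s, HasDerivAt (fun y => f y z.2) (f₁ z.1 z.2) z.1)
    (h₂ : ∀ z ∈ s, HasDerivAt (fun τ => f z.1 τ) (f₂ z.1 z.2) z.2)
    (hc₁ : ContinuousOn (fun z : ℝ × ℝ => f₁ z.1 z.2) s)
    (hc₂ : ContinuousOn (fun z : ℝ × ℝ => f₂ z.1 z.2) s) {z : ℝ × ℝ} (hz : z ∈ s) :
    HasFDerivAt (fun z : ℝ × ℝ => f z.1 z.2)
      (f₁ z.1 z.2 • ContinuousLinearMap.fst ℝ ℝ ℝ + f₂ z.1 z.2 • ContinuousLinearMap.snd ℝ ℝ ℝ)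
      z := by
  have hcont := (ContinuousLinearMap.toSpanSingletonCLE (𝕜 := ℝ) (E := ℝ)).continuous
  have hsz : ∀ᶠ v in 𝓝 z, v ∈ s := hs.mem_nhds hz
  have h := (hasStrictFDerivAt_uncurry_coprod (𝕜 := ℝ) (u := z) (f := f)
    (f₁ := fun x t => ContinuousLinearMap.toSpanSingleton ℝ (f₁ x t))
    (f₂ := fun x t => ContinuousLinearMap.toSpanSingleton ℝ (f₂ x t))
    (hsz.mono fun v hv => (h₁ v hv).hasFDerivAt) (hsz.mono fun v hv => (h₂ v hv).hasFDerivAt)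
    (hcont.continuousAt.comp (hc₁.continuousAt (hs.mem_nhds hz)))
    (hcont.continuousAt.comp (hc₂.continuousAt (hs.mem_nhds hz)))).hasFDerivAt
  refine h.congr_fderiv ?_
  ext <;> simp [Function.HasUncurry.uncurry]

end Slices

lemma isOpen_setOf_snd_pos : IsOpen {z : ℝ × ℝ | 0 < z.2} :=
  isOpen_lt continuous_const continuous_snd

lemma continuous_slice_fst {f : ℝ → ℝ → ℝ}
    (hf : ContinuousOn (fun z : ℝ × ℝ => f z.1 z.2) {z : ℝ × ℝ | 0 < z.2}) {t : ℝ} (ht : 0 < t) :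
    Continuous (fun x => f x t) :=
  hf.comp_continuous (f := fun x : ℝ => (x, t)) (by fun_prop) fun _ => ht

lemma contDiff_slice_fst {f : ℝ → ℝ → ℝ} {n : WithTop ℕ∞}
    (hf : ContDiffOn ℝ n (fun z : ℝ × ℝ => f z.1 z.2) {z : ℝ × ℝ | 0 < z.2}) {t : ℝ} (ht : 0 < t) :
    ContDiff ℝ n (fun x => f x t) :=
  hf.comp_contDiff (f := fun x : ℝ => (x, t)) (by fun_prop) fun _ => ht

lemma hasDerivAt_intervalIntegral_of_continuousOn {f f' : ℝ → ℝ → ℝ}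
    (hf : ContinuousOn (fun z : ℝ × ℝ => f z.1 z.2) {z : ℝ × ℝ | 0 < z.2})
    (hf' : ContinuousOn (fun z : ℝ × ℝ => f' z.1 z.2) {z : ℝ × ℝ | 0 < z.2})
    (hd : ∀ x t, 0 < t → HasDerivAt (fun τ => f x τ) (f' x t) t) (a b : ℝ) {t : ℝ} (ht : 0 < t) :
    HasDerivAt (fun τ => ∫ x in a..b, f x τ) (∫ x in a..b, f' x t) t := by
  have hpos : ∀ τ ∈ Icc (t / 2) (2 * t), 0 < τ := fun τ hτ => (half_pos ht).trans_le hτ.1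
  obtain ⟨C, hC⟩ := ((isCompact_uIcc (a := a) (b := b)).prod
    (isCompact_Icc (a := t / 2) (b := 2 * t))).exists_bound_of_continuousOn
      (hf'.mono fun z hz => hpos z.2 hz.2)
  have hs : Icc (t / 2) (2 * t) ∈ 𝓝 t := Icc_mem_nhds (by linarith) (by linarith)
  refine (intervalIntegral.hasDerivAt_integral_of_dominated_loc_of_deriv_le
    (F := fun τ x => f x τ) (F' := fun τ x => f' x τ) (bound := fun _ => C) hs
    (Filter.eventually_of_mem hs fun τ hτ =>
      (continuous_slice_fst hf (hpos τ hτ)).aestronglyMeasurable)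
    ((continuous_slice_fst hf ht).intervalIntegrable _ _)
    (continuous_slice_fst hf' ht).aestronglyMeasurable
    (Eventually.of_forall fun x hx τ hτ => hC (x, τ) ⟨uIoc_subset_uIcc hx, hτ⟩)
    intervalIntegrable_const
    (Eventually.of_forall fun x _ τ hτ => hd x τ (hpos τ hτ))).2

section WeakConvergence

variable {ι : Type*} {l : Filter ι} {v : ι → ℝ → ℝ} {M : ℝ}

lemma tendsto_integral_mul_of_hasCompactSupport (hM : 0 ≤ M)
    (hv : ∀ᶠ i in l, AEStronglyMeasurable (v i)) (hbound : ∀ᶠ i in l, ∀ᵐ x, ‖v i x‖ ≤ M)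
    (hlim : ∀ η : ℝ → ℝ, Continuous η → HasCompactSupport η →
      Tendsto (fun i => ∫ x, η x * v i x) l (𝓝 0))
    {K : ℝ → ℝ} (hK : Integrable K) : Tendsto (fun i => ∫ x, K x * v i x) l (𝓝 0) := by
  rw [Metric.tendsto_nhds]
  intro ε hε
  obtain ⟨η, hηs, hηK, hηc, hηi⟩ :=
    hK.exists_hasCompactSupport_integral_sub_le (ε := ε / (2 * (M + 1))) (by positivity)
  filter_upwards [Metric.tendsto_nhds.1 (hlim η hηc hηs) (ε / 2) (half_pos hε), hv, hbound]
    with i hi hvi hbi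
  have hKη : Integrable fun x => (K x - η x) * v i x := (hK.sub hηi).mul_bdd hvi hbi
  have hsplit : ∫ x, K x * v i x = (∫ x, η x * v i x) + ∫ x, (K x - η x) * v i x := by
    rw [← integral_add (hηi.mul_bdd hvi hbi) hKη]
    congr 1 with x
    ring
  have herror : ‖∫ x, (K x - η x) * v i x‖ ≤ ε / 2 := calc
    _ ≤ ∫ x, ‖K x - η x‖ * M := norm_integral_le_of_norm_le ((hK.sub hηi).norm.mul_const M) <|
        hbi.mono fun x hx => (norm_mul _ _).trans_le (by gcongr)
    _ = (∫ x, ‖K x - η x‖) * M := integral_mul_const _ _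
    _ ≤ ε / (2 * (M + 1)) * (M + 1) := by gcongr; linarith
    _ = ε / 2 := by field_simp
  rw [dist_zero_right] at hi ⊢
  rw [hsplit]
  linarith [norm_add_le (∫ x, η x * v i x) (∫ x, (K x - η x) * v i x)]

lemma tendsto_intervalIntegral_mul_of_forall_integrable
    (hlim : ∀ K : ℝ → ℝ, Integrable K → Tendsto (fun i => ∫ x, K x * v i x) l (𝓝 0))
    {k : ℝ → ℝ} (hk : Continuous k) (a b : ℝ) :
    Tendsto (fun i => ∫ x in a..b, k x * v i x) l (𝓝 0) := by
  have hIoc : ∀ a b : ℝ, Tendsto (fun i => ∫ x in Ioc a b, k x * v i x) l (𝓝 0) := by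
    intro a b
    have hK : Integrable ((Ioc a b).indicator k) :=
      (integrable_indicator_iff measurableSet_Ioc).2
        (hk.integrableOn_Icc.mono_set Ioc_subset_Icc_self)
    simpa only [← indicator_mul_left, integral_indicator measurableSet_Ioc] using hlim _ hK
  simpa only [sub_zero] using! (hIoc a b).sub (hIoc b a)

end WeakConvergence

/-- The time derivative `ν ∂ₓ u - f(u)` of a potential of a solution `u` of Burgers' equation. -/
noncomputable def burgersRate (ν : ℝ) (u : ℝ → ℝ → ℝ) (x t : ℝ) : ℝ :=
  ν * deriv (fun y => u y t) x - u x t ^ 2 / 2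

lemma continuousOn_burgersRate (ν : ℝ) {u : ℝ → ℝ → ℝ}
    (hu : ContDiffOn ℝ ∞ (fun z : ℝ × ℝ => u z.1 z.2) {z : ℝ × ℝ | 0 < z.2}) :
    ContinuousOn (fun z : ℝ × ℝ => burgersRate ν u z.1 z.2) {z : ℝ × ℝ | 0 < z.2} :=
  ((contDiffOn_deriv_slice_fst isOpen_setOf_snd_pos hu).continuousOn.const_smul ν).sub
    ((hu.continuousOn.pow 2).div_const 2)

/-- `U` is a potential of the smooth solution `u` of Burgers' equation: `∂ₓ U = u` and
`∂ₜ U = ν ∂ₓ u - f(u)` for `t > 0`, and `U` is continuous up to `t = 0` with at most linear growth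
in `x`, which makes the Cole-Hopf transform of `U` the unique solution of a Cauchy problem. -/
structure IsPotential (ν : ℝ) (u U : ℝ → ℝ → ℝ) : Prop where
  smooth : ContDiffOn ℝ ∞ (fun z : ℝ × ℝ => u z.1 z.2) {z : ℝ × ℝ | 0 < z.2}
  hasFDerivAt : ∀ x t, 0 < t → HasFDerivAt (fun z : ℝ × ℝ => U z.1 z.2)
    (u x t • ContinuousLinearMap.fst ℝ ℝ ℝ + burgersRate ν u x t • ContinuousLinearMap.snd ℝ ℝ ℝ)
    (x, t)
  continuousOn : ContinuousOn (fun z : ℝ × ℝ => U z.1 z.2) {z : ℝ × ℝ | 0 ≤ z.2}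
  growth : ∀ T, ∃ C, ∀ x t, 0 ≤ t → t ≤ T → |U x t| ≤ C * (1 + |x|)

/-- The rate of change of the average over `[0, 1]` of a potential of `u`. -/
noncomputable def averageRate (ν : ℝ) (u : ℝ → ℝ → ℝ) (t : ℝ) : ℝ :=
  ν * (u 1 t - u 0 t) - ∫ x in (0 : ℝ)..1, u x t ^ 2 / 2

/-- The potential of `u` that vanishes at the origin. It is normalised through its average over
`[0, 1]`, whose rate of change is bounded, because `∂ₓ u` need not be integrable in time near
`t = 0`. -/
noncomputable def potential (ν : ℝ) (u : ℝ → ℝ → ℝ) (x t : ℝ) : ℝ :=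
  (∫ τ in (0 : ℝ)..t, averageRate ν u τ) + (∫ z in (0 : ℝ)..x, u z t)
    - (∫ z in (0 : ℝ)..1, (1 - z) * u z t) + ∫ z in (0 : ℝ)..1, (1 - z) * u z 0

lemma abs_intervalIntegral_sub_le {v : ℝ → ℝ} (hm : AEStronglyMeasurable v volume) {M : ℝ}
    (hM : ∀ᵐ x, ‖v x‖ ≤ M) (a x y : ℝ) :
    |(∫ z in a..x, v z) - ∫ z in a..y, v z| ≤ M * |x - y| := by
  have hi : ∀ a b, IntervalIntegrable v volume a b := fun a b =>
    (intervalIntegrable_const (c := M)).mono_fun hm.restrict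
      ((ae_restrict_of_ae hM).mono fun z hz => hz.trans (le_abs_self M))
  rw [intervalIntegral.integral_interval_sub_left (hi _ _) (hi _ _)]
  exact intervalIntegral.norm_integral_le_of_norm_le_const_ae (hM.mono fun z hz _ => hz)

namespace IsBoundedSolution

variable {f : ℝ → ℝ} {ν : ℝ} {u₀ : ℝ → ℝ} {u : ℝ → ℝ → ℝ} {x t : ℝ}

lemma hasDerivAt_fst (hu : IsBoundedSolution f ν u₀ u) (ht : 0 < t) :
    HasDerivAt (fun y => u y t) (deriv (fun y => u y t) x) x :=
  hasDerivAt_deriv_slice_fst isOpen_setOf_snd_pos hu.smooth ht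

lemma hasDerivAt_snd (hu : IsBoundedSolution f ν u₀ u) (ht : 0 < t) :
    HasDerivAt (fun τ => u x τ) (deriv (fun τ => u x τ) t) t :=
  hasDerivAt_deriv_slice_snd isOpen_setOf_snd_pos hu.smooth ht

lemma continuousOn_deriv_snd (hu : IsBoundedSolution f ν u₀ u) :
    ContinuousOn (fun z : ℝ × ℝ => deriv (fun τ => u z.1 τ) z.2) {z : ℝ × ℝ | 0 < z.2} :=
  (contDiffOn_deriv_slice_snd isOpen_setOf_snd_pos hu.smooth).continuousOn

lemma continuousOn_deriv_fst (hu : IsBoundedSolution f ν u₀ u) :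
    ContinuousOn (fun z : ℝ × ℝ => deriv (fun y => u y z.2) z.1) {z : ℝ × ℝ | 0 < z.2} :=
  (contDiffOn_deriv_slice_fst isOpen_setOf_snd_pos hu.smooth).continuousOn

lemma continuous_slice (hu : IsBoundedSolution f ν u₀ u) (ht : 0 < t) :
    Continuous fun x => u x t :=
  continuous_slice_fst hu.smooth.continuousOn ht

lemma aestronglyMeasurable (hu : IsBoundedSolution f ν u₀ u) (hu₀ : MemLp u₀ ⊤ volume)
    (ht : 0 ≤ t) : AEStronglyMeasurable (fun x => u x t) volume := by
  rcases ht.eq_or_lt with rfl | ht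
  · simpa only [hu.initial_value] using hu₀.aestronglyMeasurable
  · exact (hu.continuous_slice ht).aestronglyMeasurable

lemma exists_ae_bound (hu : IsBoundedSolution f ν u₀ u) (hu₀ : MemLp u₀ ⊤ volume) :
    ∃ M, 0 ≤ M ∧ ∀ t, 0 ≤ t → ∀ᵐ x, ‖u x t‖ ≤ M := by
  obtain ⟨M, hM⟩ := hu.bounded
  refine ⟨max M (lpNorm u₀ ⊤ volume), le_max_of_le_right lpNorm_nonneg, fun t ht => ?_⟩
  rcases ht.eq_or_lt with rfl | ht
  · simp only [hu.initial_value]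
    exact (ae_le_lpNorm_exponent_top hu₀).mono fun x hx => hx.trans (le_max_right _ _)
  · exact Eventually.of_forall fun x => (hM x t ht).trans (le_max_left _ _)

lemma tendsto_integral_mul_sub (hu : IsBoundedSolution f ν u₀ u) {η : ℝ → ℝ} (hη : Continuous η)
    (hηs : HasCompactSupport η) :
    Tendsto (fun t => ∫ x, η x * (u x t - u₀ x)) (𝓝[>] 0) (𝓝 0) := by
  let χ : ContDiffBump (0 : ℝ) := ⟨1, 2, one_pos, one_lt_two⟩
  have hχ : ∀ t : ℝ, |t| ≤ 1 → χ t = 1 := fun t ht =>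
    χ.one_of_mem_closedBall (by simpa using ht)
  have hsupp : HasCompactSupport fun z : ℝ × ℝ => η z.1 * χ z.2 := by
    refine HasCompactSupport.intro (hηs.isCompact.prod χ.hasCompactSupport.isCompact)
      fun z hz => ?_
    by_contra hne
    exact hz ⟨subset_tsupport _ (left_ne_zero_of_mul hne),
      subset_tsupport _ (right_ne_zero_of_mul hne)⟩
  have hlim := hu.initial_weak (fun z => η z.1 * χ z.2)
    ((hη.comp continuous_fst).mul (χ.continuous.comp continuous_snd)) hsupp
  refine hlim.congr' ?_
  filter_upwards [Ioo_mem_nhdsGT one_pos] with t ht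
  simp only [hχ t (abs_le.2 ⟨by linarith [ht.1], ht.2.le⟩), hχ 0 (by simp),
    mul_one, mul_sub]

lemma tendsto_intervalIntegral_mul (hu : IsBoundedSolution f ν u₀ u) (hu₀ : MemLp u₀ ⊤ volume)
    {k : ℝ → ℝ} (hk : Continuous k) (a b : ℝ) :
    Tendsto (fun t => ∫ x in a..b, k x * u x t) (𝓝[>] 0) (𝓝 (∫ x in a..b, k x * u x 0)) := by
  obtain ⟨M, hM0, hM⟩ := hu.exists_ae_bound hu₀
  have hint : ∀ t, 0 ≤ t → IntervalIntegrable (fun x => k x * u x t) volume a b := fun t ht =>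
    ((intervalIntegrable_const (c := M)).mono_fun (hu.aestronglyMeasurable hu₀ ht).restrict
      ((ae_restrict_of_ae (hM t ht)).mono fun z hz => hz.trans (le_abs_self M))).continuousOn_mul
      hk.continuousOn
  have hdiff : Tendsto (fun t => ∫ x in a..b, k x * (u x t - u x 0)) (𝓝[>] 0) (𝓝 0) := by
    refine tendsto_intervalIntegral_mul_of_forall_integrable (fun K hK =>
      tendsto_integral_mul_of_hasCompactSupport (M := M + M) (by positivity) ?_ ?_ ?_ hK) hk a b
    · filter_upwards [self_mem_nhdsWithin] with t ht
      exact (hu.aestronglyMeasurable hu₀ (le_of_lt ht)).sub (hu.aestronglyMeasurable hu₀ le_rfl)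
    · filter_upwards [self_mem_nhdsWithin] with t ht
      filter_upwards [hM t (le_of_lt ht), hM 0 le_rfl] with x hx hx0
      exact norm_sub_le_of_le hx hx0
    · simpa only [hu.initial_value] using fun η hη hηs => hu.tendsto_integral_mul_sub hη hηs
  rw [← tendsto_sub_nhds_zero_iff]
  refine hdiff.congr' ?_
  filter_upwards [self_mem_nhdsWithin] with t ht
  simp only [mul_sub]
  exact intervalIntegral.integral_sub (hint t (le_of_lt ht)) (hint 0 le_rfl)

lemma hasDerivAt_burgersRate (hu : IsBoundedSolution burgersFlux ν u₀ u) (ht : 0 < t) :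
    HasDerivAt (fun y => burgersRate ν u y t) (deriv (fun τ => u x τ) t) x := by
  have hx := hu.hasDerivAt_fst (x := x) ht
  have hxx : HasDerivAt (deriv fun y => u y t) (iteratedDeriv 2 (fun y => u y t) x) x := by
    rw [iteratedDeriv_succ, iteratedDeriv_one]
    exact hasDerivAt_deriv_slice_fst (f := fun x t => deriv (fun y => u y t) x)
      isOpen_setOf_snd_pos (contDiffOn_deriv_slice_fst isOpen_setOf_snd_pos hu.smooth) ht
  have hflux : HasDerivAt (fun y => burgersFlux (u y t)) (u x t * deriv (fun y => u y t) x) x :=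
    ((hx.pow 2).div_const 2).congr_deriv (by push_cast; ring)
  have heq := hu.equation x t ht
  rw [hflux.deriv] at heq
  exact ((hxx.const_mul ν).sub hflux).congr_deriv (by linarith)

lemma continuousOn_averageRate (hu : IsBoundedSolution f ν u₀ u) :
    ContinuousOn (averageRate ν u) (Ioi 0) := by
  have hsnd : ∀ x, ContinuousOn (fun t => u x t) (Ioi 0) := fun x t ht =>
    (hu.hasDerivAt_snd ht).continuousAt.continuousWithinAt
  refine (((hsnd 1).sub (hsnd 0)).const_smul ν).sub fun t ht => ?_
  exact (hasDerivAt_intervalIntegral_of_continuousOn (f := fun x t => u x t ^ 2 / 2)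
    (f' := fun x t => u x t * deriv (fun τ => u x τ) t) ((hu.smooth.continuousOn.pow 2).div_const 2)
    (hu.smooth.continuousOn.mul hu.continuousOn_deriv_snd)
    (fun x t ht => (((hu.hasDerivAt_snd ht).pow 2).div_const 2).congr_deriv (by push_cast; ring))
    0 1 ht).continuousAt.continuousWithinAt

lemma exists_abs_averageRate_le (hu : IsBoundedSolution f ν u₀ u) :
    ∃ C, ∀ t, 0 < t → |averageRate ν u t| ≤ C := by
  obtain ⟨M, hM⟩ := hu.bounded
  refine ⟨|ν| * (M + M) + M ^ 2 / 2, fun t ht => ?_⟩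
  have hflux : |∫ x in (0 : ℝ)..1, u x t ^ 2 / 2| ≤ M ^ 2 / 2 := by
    have h := intervalIntegral.norm_integral_le_of_norm_le_const (a := 0) (b := 1)
      (f := fun x => u x t ^ 2 / 2) (C := M ^ 2 / 2) fun x _ => by
        rw [Real.norm_of_nonneg (by positivity), ← sq_abs (u x t)]
        gcongr
        exact hM x t ht
    rwa [sub_zero, abs_one, mul_one] at h
  calc |averageRate ν u t|
      ≤ |ν * (u 1 t - u 0 t)| + |∫ x in (0 : ℝ)..1, u x t ^ 2 / 2| := abs_sub _ _
    _ ≤ |ν| * (M + M) + M ^ 2 / 2 := by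
      rw [abs_mul]
      gcongr
      exact (abs_sub _ _).trans (add_le_add (hM 1 t ht) (hM 0 t ht))

lemma intervalIntegrable_averageRate (hu : IsBoundedSolution f ν u₀ u) (ht : 0 ≤ t) :
    IntervalIntegrable (averageRate ν u) volume 0 t := by
  obtain ⟨C, hC⟩ := hu.exists_abs_averageRate_le
  rw [intervalIntegrable_iff_integrableOn_Ioc_of_le ht]
  exact Integrable.of_bound ((hu.continuousOn_averageRate.mono Ioc_subset_Ioi_self
    ).aestronglyMeasurable measurableSet_Ioc) C
    ((ae_restrict_iff' measurableSet_Ioc).2 (Eventually.of_forall fun τ hτ => hC τ hτ.1))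

lemma hasDerivAt_potential_fst (hu : IsBoundedSolution f ν u₀ u) (ht : 0 < t) :
    HasDerivAt (fun y => potential ν u y t) (u x t) x :=
  ((((hu.continuous_slice ht).integral_hasStrictDerivAt 0 x).hasDerivAt.const_add _).sub_const
    _).add_const _

lemma integral_deriv_snd (hu : IsBoundedSolution burgersFlux ν u₀ u) (ht : 0 < t) :
    ∫ y in (0 : ℝ)..x, deriv (fun τ => u y τ) t = burgersRate ν u x t - burgersRate ν u 0 t :=
  intervalIntegral.integral_eq_sub_of_hasDerivAt (fun _ _ => hu.hasDerivAt_burgersRate ht)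
    ((continuous_slice_fst hu.continuousOn_deriv_snd ht).intervalIntegrable _ _)

lemma integral_burgersRate (hu : IsBoundedSolution f ν u₀ u) (ht : 0 < t) :
    ∫ y in (0 : ℝ)..1, burgersRate ν u y t = averageRate ν u t := by
  have hcx : Continuous fun y => deriv (fun y => u y t) y :=
    continuous_slice_fst (f := fun x t => deriv (fun y => u y t) x) hu.continuousOn_deriv_fst ht
  have hux : ∫ y in (0 : ℝ)..1, deriv (fun y => u y t) y = u 1 t - u 0 t :=
    intervalIntegral.integral_eq_sub_of_hasDerivAt (fun y _ => hu.hasDerivAt_fst ht)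
      (hcx.intervalIntegrable _ _)
  have hflux : Continuous fun y => u y t ^ 2 / 2 := ((hu.continuous_slice ht).pow 2).div_const 2
  unfold burgersRate averageRate
  rw [intervalIntegral.integral_sub ((hcx.const_mul ν).intervalIntegrable _ _)
    (hflux.intervalIntegrable _ _), intervalIntegral.integral_const_mul, hux]

lemma integral_one_sub_mul_deriv_snd (hu : IsBoundedSolution burgersFlux ν u₀ u) (ht : 0 < t) :
    ∫ y in (0 : ℝ)..1, (1 - y) * deriv (fun τ => u y τ) t
      = averageRate ν u t - burgersRate ν u 0 t := by
  rw [intervalIntegral.integral_mul_deriv_eq_deriv_mul (u := fun y => 1 - y) (u' := fun _ => -1)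
    (v := fun y => burgersRate ν u y t) (fun y _ => (hasDerivAt_id y).const_sub 1)
    (fun y _ => hu.hasDerivAt_burgersRate ht) (by simp)
    ((continuous_slice_fst hu.continuousOn_deriv_snd ht).intervalIntegrable _ _)]
  simp only [sub_self, zero_mul, sub_zero, one_mul, neg_one_mul, intervalIntegral.integral_neg,
    hu.integral_burgersRate ht]
  ring

lemma hasDerivAt_potential_snd (hu : IsBoundedSolution burgersFlux ν u₀ u) (ht : 0 < t) :
    HasDerivAt (fun τ => potential ν u x τ) (burgersRate ν u x t) t := by
  have hc : ContinuousOn (fun z : ℝ × ℝ => 1 - z.1) {z : ℝ × ℝ | 0 < z.2} := by fun_prop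
  have haverage : HasDerivAt (fun τ => ∫ τ in (0 : ℝ)..τ, averageRate ν u τ)
      (averageRate ν u t) t :=
    intervalIntegral.integral_hasDerivAt_right (hu.intervalIntegrable_averageRate ht.le)
      (hu.continuousOn_averageRate.stronglyMeasurableAtFilter isOpen_Ioi _ ht)
      (hu.continuousOn_averageRate.continuousAt (Ioi_mem_nhds ht))
  have hprimitive := hasDerivAt_intervalIntegral_of_continuousOn hu.smooth.continuousOn
    hu.continuousOn_deriv_snd (fun x t ht => hu.hasDerivAt_snd ht) 0 x ht
  have hmoment := hasDerivAt_intervalIntegral_of_continuousOn (f := fun x t => (1 - x) * u x t)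
    (f' := fun x t => (1 - x) * deriv (fun τ => u x τ) t) (hc.mul hu.smooth.continuousOn)
    (hc.mul hu.continuousOn_deriv_snd) (fun x t ht => (hu.hasDerivAt_snd ht).const_mul _) 0 1 ht
  have h := ((haverage.add hprimitive).sub hmoment).add_const
    (∫ z in (0 : ℝ)..1, (1 - z) * u z 0)
  rw [hu.integral_deriv_snd ht, hu.integral_one_sub_mul_deriv_snd ht] at h
  exact h.congr_deriv (by ring)

lemma continuousOn_potential_snd (hu : IsBoundedSolution burgersFlux ν u₀ u)
    (hu₀ : MemLp u₀ ⊤ volume) (x : ℝ) : ContinuousOn (fun t => potential ν u x t) (Ici 0) := by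
  intro t ht
  rcases eq_or_lt_of_le (mem_Ici.1 ht) with rfl | ht
  · have haverage : ContinuousWithinAt (fun t => ∫ τ in (0 : ℝ)..t, averageRate ν u τ)
        (Ioi 0) 0 := by
      refine ((intervalIntegral.continuousOn_primitive_interval'
        (hu.intervalIntegrable_averageRate zero_le_one) left_mem_uIcc) 0
        left_mem_uIcc).mono_of_mem_nhdsWithin ?_
      rw [uIcc_of_le zero_le_one]
      exact Icc_mem_nhdsGT_of_mem ⟨le_rfl, one_pos⟩
    have hprimitive := hu.tendsto_intervalIntegral_mul hu₀ (continuous_const (y := 1)) 0 x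
    have hmoment := hu.tendsto_intervalIntegral_mul hu₀ (continuous_const.sub continuous_id
      : Continuous fun z : ℝ => 1 - z) 0 1
    simp only [one_mul] at hprimitive
    exact continuousWithinAt_Ioi_iff_Ici.1
      (((haverage.tendsto.add hprimitive).sub hmoment).add_const _)
  · exact (hu.hasDerivAt_potential_snd ht).continuousAt.continuousWithinAt

lemma exists_abs_potential_sub_le (hu : IsBoundedSolution f ν u₀ u)
    (hu₀ : MemLp u₀ ⊤ volume) :
    ∃ M, 0 ≤ M ∧ ∀ x y t, 0 ≤ t → |potential ν u x t - potential ν u y t| ≤ M * |x - y| := by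
  obtain ⟨M, hM0, hM⟩ := hu.exists_ae_bound hu₀
  refine ⟨M, hM0, fun x y t ht => ?_⟩
  refine le_of_eq_of_le ?_ (abs_intervalIntegral_sub_le (hu.aestronglyMeasurable hu₀ ht) (hM t ht)
    0 x y)
  unfold potential
  congr 1
  ring

lemma continuousOn_potential (hu : IsBoundedSolution burgersFlux ν u₀ u)
    (hu₀ : MemLp u₀ ⊤ volume) :
    ContinuousOn (fun z : ℝ × ℝ => potential ν u z.1 z.2) {z : ℝ × ℝ | 0 ≤ z.2} := by
  obtain ⟨M, -, hM⟩ := hu.exists_abs_potential_sub_le hu₀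
  rintro ⟨x, t⟩ ht
  have hsnd : Tendsto (fun z : ℝ × ℝ => potential ν u x z.2) (𝓝[{z : ℝ × ℝ | 0 ≤ z.2}] (x, t))
      (𝓝 (potential ν u x t)) :=
    (hu.continuousOn_potential_snd hu₀ x t ht).tendsto.comp <|
      continuous_snd.continuousWithinAt.tendsto_nhdsWithin fun z hz => hz
  have hfst : Tendsto (fun z : ℝ × ℝ => potential ν u z.1 z.2 - potential ν u x z.2)
      (𝓝[{z : ℝ × ℝ | 0 ≤ z.2}] (x, t)) (𝓝 0) := by
    refine squeeze_zero_norm' (a := fun z : ℝ × ℝ => M * |z.1 - x|)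
      (eventually_mem_nhdsWithin.mono fun z hz => hM z.1 x z.2 hz) ?_
    have h : Continuous fun z : ℝ × ℝ => M * |z.1 - x| := by fun_prop
    simpa using (h.tendsto (x, t)).mono_left nhdsWithin_le_nhds
  simpa [ContinuousWithinAt] using hsnd.add hfst

lemma exists_abs_potential_le (hu : IsBoundedSolution burgersFlux ν u₀ u)
    (hu₀ : MemLp u₀ ⊤ volume) (T : ℝ) :
    ∃ C, ∀ x t, 0 ≤ t → t ≤ T → |potential ν u x t| ≤ C * (1 + |x|) := by
  obtain ⟨M, hM0, hM⟩ := hu.exists_abs_potential_sub_le hu₀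
  obtain ⟨C, hC⟩ := (isCompact_Icc (a := (0 : ℝ)) (b := T)).exists_bound_of_continuousOn
    ((hu.continuousOn_potential_snd hu₀ 0).mono Icc_subset_Ici_self)
  refine ⟨C + M, fun x t h0 hT => ?_⟩
  have hCt : |potential ν u 0 t| ≤ C := hC t ⟨h0, hT⟩
  have hxt := hM x 0 t h0
  rw [sub_zero] at hxt
  have hC0 : 0 ≤ C := (abs_nonneg _).trans hCt
  calc |potential ν u x t| ≤ |potential ν u x t - potential ν u 0 t| + |potential ν u 0 t| := by
        simpa using abs_add_le (potential ν u x t - potential ν u 0 t) (potential ν u 0 t)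
    _ ≤ M * |x| + C := add_le_add hxt hCt
    _ ≤ (C + M) * (1 + |x|) := by nlinarith [mul_nonneg hC0 (abs_nonneg x)]

lemma isPotential_potential (hu : IsBoundedSolution burgersFlux ν u₀ u)
    (hu₀ : MemLp u₀ ⊤ volume) : IsPotential ν u (potential ν u) where
  smooth := hu.smooth
  hasFDerivAt x t ht := hasFDerivAt_of_hasDerivAt_slices isOpen_setOf_snd_pos
    (fun _ hz => hu.hasDerivAt_potential_fst hz) (fun _ hz => hu.hasDerivAt_potential_snd hz)
    hu.smooth.continuousOn (continuousOn_burgersRate ν hu.smooth) (z := (x, t)) ht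
  continuousOn := hu.continuousOn_potential hu₀
  growth := hu.exists_abs_potential_le hu₀

end IsBoundedSolution

lemma second_deriv_nonpos_of_isLocalMax {f f' : ℝ → ℝ} {f'' x : ℝ}
    (hf : ∀ y, HasDerivAt f (f' y) y) (hf' : HasDerivAt f' f'' x) (hmax : IsLocalMax f x) :
    f'' ≤ 0 := by
  by_contra! hpos
  have hd : deriv f = f' := funext fun y => (hf y).deriv
  have hmin : IsLocalMin f x := isLocalMin_of_deriv_deriv_pos (by rwa [hd, hf'.deriv])
    hmax.deriv_eq_zero (hf x).continuousAt
  have hconst : f =ᶠ[𝓝 x] fun _ => f x := by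
    filter_upwards [hmax, hmin] with y h1 h2 using le_antisymm h1 h2
  have hzero := hconst.deriv.deriv_eq
  rw [hd, hf'.deriv, deriv_const', deriv_const] at hzero
  exact hpos.ne' hzero

lemma deriv_nonneg_of_forall_le_left {f : ℝ → ℝ} {f' a t : ℝ} (ht : a < t)
    (hf : HasDerivAt f f' t) (hmax : ∀ s ∈ Ioo a t, f s ≤ f t) : 0 ≤ f' := by
  refine ge_of_tendsto ((hasDerivWithinAt_iff_tendsto_slope' self_notMem_Iio).1
    (hf.hasDerivWithinAt (s := Iio t))) ?_
  filter_upwards [Ioo_mem_nhdsLT ht] with s hs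
  rw [slope_def_field]
  exact div_nonneg_of_nonpos (sub_nonpos.2 (hmax s hs)) (sub_nonpos.2 hs.2.le)

lemma nonpos_of_strict_heat_subsolution {w : ℝ → ℝ → ℝ} {ν a b T : ℝ} (hν : 0 ≤ ν)
    (hc : ContinuousOn (fun z : ℝ × ℝ => w z.1 z.2) (Icc a b ×ˢ Icc 0 T))
    (hstrict : ∀ x t, 0 < t → ∃ (wx : ℝ → ℝ) (wxx wt : ℝ),
      (∀ y, HasDerivAt (fun y => w y t) (wx y) y) ∧ HasDerivAt wx wxx x ∧
        HasDerivAt (fun τ => w x τ) wt t ∧ (0 < w x t → wt < ν * wxx))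
    (hinitial : ∀ x, w x 0 ≤ 0) (ha : ∀ t ∈ Icc 0 T, w a t ≤ 0) (hb : ∀ t ∈ Icc 0 T, w b t ≤ 0)
    {x t : ℝ} (hx : x ∈ Icc a b) (ht : t ∈ Icc 0 T) : w x t ≤ 0 := by
  obtain ⟨⟨y, s⟩, ⟨hy, hs⟩, hmaxOn⟩ := (isCompact_Icc.prod isCompact_Icc).exists_isMaxOn
    ⟨(x, t), hx, ht⟩ hc
  have hmax : ∀ z ∈ Icc a b, ∀ τ ∈ Icc 0 T, w z τ ≤ w y s := fun z hz τ hτ =>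
    isMaxOn_iff.1 hmaxOn (z, τ) ⟨hz, hτ⟩
  refine (hmax x hx t ht).trans ?_
  by_contra! hpos
  have hs0 : 0 < s := hs.1.lt_of_ne fun h => (hinitial y).not_gt (h ▸ hpos)
  have hay : a < y := hy.1.lt_of_ne fun h => (ha s hs).not_gt (h ▸ hpos)
  have hyb : y < b := hy.2.lt_of_ne fun h => (hb s hs).not_gt (h ▸ hpos)
  obtain ⟨wx, wxx, wt, hwx, hwxx, hwt, hlt⟩ := hstrict y s hs0
  have hxx : wxx ≤ 0 := second_deriv_nonpos_of_isLocalMax hwx hwxx <|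
    Filter.eventually_of_mem (Icc_mem_nhds hay hyb) fun z hz => hmax z hz s hs
  have htime : 0 ≤ wt := deriv_nonneg_of_forall_le_left hs0 hwt fun τ hτ =>
    hmax y hy τ ⟨hτ.1.le, hτ.2.le.trans hs.2⟩
  linarith [hlt hpos, mul_nonpos_of_nonneg_of_nonpos hν hxx]

lemma exists_forall_exp_le_cosh (C B : ℝ) {ε : ℝ} (hε : 0 < ε) :
    ∃ R, ∀ y, R ≤ |y| → C * Real.exp (B * |y|) ≤ ε * Real.cosh ((B + 1) * y) := by
  refine ⟨2 * C / ε, fun y hy => ?_⟩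
  have hC : 2 * C ≤ ε * Real.exp |y| := by
    rw [div_le_iff₀ hε] at hy
    nlinarith [Real.add_one_le_exp |y|]
  have hcosh : Real.exp |y| * Real.exp (B * |y|) ≤ 2 * Real.cosh ((B + 1) * y) := calc
    _ = Real.exp ((B + 1) * |y|) := by rw [← Real.exp_add]; congr 1; ring
    _ ≤ Real.exp |(B + 1) * y| := by
      rw [abs_mul]
      gcongr
      exact le_abs_self _
    _ ≤ 2 * Real.cosh ((B + 1) * y) := by
      rw [← Real.cosh_abs, Real.cosh_eq]
      linarith [Real.exp_pos (-|(B + 1) * y|)]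
  nlinarith [mul_le_mul_of_nonneg_right hC (Real.exp_pos (B * |y|)).le,
    mul_le_mul_of_nonneg_left hcosh hε.le]

/-- `v` solves the heat equation with diffusivity `ν` for `t > 0`, is continuous up to `t = 0` and
grows at most exponentially in `x`, a class in which the Cauchy problem has at most one
solution. -/
structure IsHeatSolution (ν : ℝ) (v : ℝ → ℝ → ℝ) : Prop where
  equation : ∀ x t, 0 < t → ∃ (vx : ℝ → ℝ) (vxx : ℝ),
    (∀ y, HasDerivAt (fun y => v y t) (vx y) y) ∧ HasDerivAt vx vxx x ∧
      HasDerivAt (fun τ => v x τ) (ν * vxx) t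
  continuousOn : ContinuousOn (fun z : ℝ × ℝ => v z.1 z.2) {z : ℝ × ℝ | 0 ≤ z.2}
  growth : ∀ T, ∃ C B, ∀ x t, 0 ≤ t → t ≤ T → |v x t| ≤ C * Real.exp (B * |x|)

namespace IsHeatSolution

variable {ν : ℝ} {v w : ℝ → ℝ → ℝ}

lemma neg (hv : IsHeatSolution ν v) : IsHeatSolution ν fun x t => -v x t where
  equation x t ht := by
    obtain ⟨vx, vxx, hx, hxx, hτ⟩ := hv.equation x t ht
    exact ⟨fun y => -vx y, -vxx, fun y => (hx y).neg, hxx.neg, hτ.neg.congr_deriv (by ring)⟩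
  continuousOn := hv.continuousOn.neg
  growth := by simpa only [abs_neg] using hv.growth

lemma add (hv : IsHeatSolution ν v) (hw : IsHeatSolution ν w) :
    IsHeatSolution ν fun x t => v x t + w x t where
  equation x t ht := by
    obtain ⟨vx, vxx, hvx, hvxx, hvτ⟩ := hv.equation x t ht
    obtain ⟨wx, wxx, hwx, hwxx, hwτ⟩ := hw.equation x t ht
    exact ⟨fun y => vx y + wx y, vxx + wxx, fun y => (hvx y).add (hwx y), hvxx.add hwxx,
      (hvτ.add hwτ).congr_deriv (by ring)⟩
  continuousOn := hv.continuousOn.add hw.continuousOn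
  growth T := by
    obtain ⟨C, B, h⟩ := hv.growth T
    obtain ⟨C', B', h'⟩ := hw.growth T
    refine ⟨|C| + |C'|, max B B', fun x t h0 hT => ?_⟩
    calc |v x t + w x t| ≤ |v x t| + |w x t| := abs_add_le _ _
      _ ≤ C * Real.exp (B * |x|) + C' * Real.exp (B' * |x|) :=
        add_le_add (h x t h0 hT) (h' x t h0 hT)
      _ ≤ |C| * Real.exp (max B B' * |x|) + |C'| * Real.exp (max B B' * |x|) := by
        gcongr
        exacts [le_abs_self C, le_max_left _ _, le_abs_self C', le_max_right _ _]
      _ = (|C| + |C'|) * Real.exp (max B B' * |x|) := by ring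

lemma le_exp_mul_cosh (hν : 0 ≤ ν) (hv : IsHeatSolution ν v) (hinitial : ∀ x, v x 0 ≤ 0)
    {C B T ε : ℝ} (hgrowth : ∀ x t, 0 ≤ t → t ≤ T → |v x t| ≤ C * Real.exp (B * |x|))
    (hε : 0 < ε) (x : ℝ) (hT : 0 ≤ T) :
    v x T ≤ ε * (Real.exp ((ν * (B + 1) ^ 2 + 1) * T) * Real.cosh ((B + 1) * x)) := by
  set b := B + 1
  set κ := ν * b ^ 2 + 1
  have hcosh : ∀ y, 0 < Real.cosh (b * y) := fun y => Real.cosh_pos _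
  obtain ⟨R, hR⟩ := exists_forall_exp_le_cosh C B hε
  obtain ⟨r, hRr, hxr⟩ : ∃ r, R ≤ r ∧ |x| ≤ r := ⟨_, le_max_left _ _, le_max_right _ _⟩
  have hside : ∀ y, r = |y| → ∀ t ∈ Icc 0 T,
      v y t - ε * (Real.exp (κ * t) * Real.cosh (b * y)) ≤ 0 := fun y hy t ht => by
    have hexp : 1 ≤ Real.exp (κ * t) := Real.one_le_exp (mul_nonneg (by positivity) ht.1)
    rw [sub_nonpos]
    calc v y t ≤ C * Real.exp (B * |y|) := (le_abs_self _).trans (hgrowth y t ht.1 ht.2)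
      _ ≤ ε * Real.cosh (b * y) := hR y (hy ▸ hRr)
      _ ≤ ε * (Real.exp (κ * t) * Real.cosh (b * y)) := by
        gcongr
        exact le_mul_of_one_le_left (hcosh y).le hexp
  have hr : r = |r| := (abs_of_nonneg ((abs_nonneg x).trans hxr)).symm
  refine sub_nonpos.1 (nonpos_of_strict_heat_subsolution hν
    (w := fun y t => v y t - ε * (Real.exp (κ * t) * Real.cosh (b * y)))
    ((hv.continuousOn.mono fun z hz => hz.2.1).sub ?_) (fun y t ht => ?_) (fun y => ?_)
    (hside (-r) (by rwa [abs_neg])) (hside r hr)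
    (abs_le.1 hxr) ⟨hT, le_rfl⟩)
  · have := Real.continuous_cosh
    fun_prop
  · obtain ⟨vx, vxx, hx, hxx, hτ⟩ := hv.equation y t ht
    have hlin : ∀ c z : ℝ, HasDerivAt (fun z => c * z) c z := fun c z => hasDerivAt_const_mul c
    refine ⟨_, _, _, fun z => (hx z).sub (((hlin b z).cosh.const_mul _).const_mul ε),
      hxx.sub ((((hlin b y).sinh.mul_const _).const_mul _).const_mul ε),
      hτ.sub ((((hlin κ t).exp).mul_const _).const_mul ε), fun _ => ?_⟩
    have hpos : 0 < ε * (Real.exp (κ * t) * Real.cosh (b * y)) := by have := hcosh y; positivity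
    simp only [κ]
    linear_combination hpos
  · have := hcosh y
    have hpos : 0 < ε * (Real.exp (κ * 0) * Real.cosh (b * y)) := by positivity
    linarith [hinitial y]

lemma nonpos (hν : 0 ≤ ν) (hv : IsHeatSolution ν v) (hinitial : ∀ x, v x 0 ≤ 0) {x t : ℝ}
    (ht : 0 ≤ t) : v x t ≤ 0 := by
  obtain ⟨C, B, hgrowth⟩ := hv.growth t
  have hlim : ContinuousWithinAt (fun ε : ℝ =>
      ε * (Real.exp ((ν * (B + 1) ^ 2 + 1) * t) * Real.cosh ((B + 1) * x))) (Ioi 0) 0 := by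
    fun_prop
  simpa using ge_of_tendsto hlim.tendsto (eventually_mem_nhdsWithin.mono fun ε hε =>
    hv.le_exp_mul_cosh hν hinitial hgrowth hε x ht)

lemma eq_of_initial_eq (hν : 0 ≤ ν) (hv : IsHeatSolution ν v) (hw : IsHeatSolution ν w)
    (hinitial : ∀ x, v x 0 = w x 0) {x t : ℝ} (ht : 0 ≤ t) : v x t = w x t := by
  have hle := (hv.add hw.neg).nonpos hν (fun y => by simp [hinitial y]) (x := x) ht
  have hge := (hw.add hv.neg).nonpos hν (fun y => by simp [hinitial y]) (x := x) ht
  linarith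

end IsHeatSolution

lemma hasDerivAt_log_sigmoid (y : ℝ) :
    HasDerivAt (fun y => Real.log (Real.sigmoid y)) (Real.sigmoid (-y)) y := by
  refine ((Real.hasDerivAt_sigmoid y).log (Real.sigmoid_pos y).ne').congr_deriv ?_
  rw [Real.sigmoid_neg, mul_div_cancel_left₀ _ (Real.sigmoid_pos y).ne']

/-- The Cole-Hopf transform, which turns a potential of a solution of Burgers' equation into a
solution of the heat equation. -/
noncomputable def coleHopf (ν : ℝ) (U : ℝ → ℝ → ℝ) (x t : ℝ) : ℝ := Real.exp (-U x t / (2 * ν))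

lemma coleHopf_inj {ν : ℝ} (hν : ν ≠ 0) {U V : ℝ → ℝ → ℝ} {x t : ℝ} :
    coleHopf ν U x t = coleHopf ν V x t ↔ U x t = V x t := by
  rw [coleHopf, coleHopf, Real.exp_eq_exp, div_left_inj' (by positivity), neg_inj]

lemma coleHopf_add_coleHopf {ν : ℝ} (hν : ν ≠ 0) (V W : ℝ → ℝ → ℝ) (x t : ℝ) :
    coleHopf ν V x t + coleHopf ν W x t = coleHopf ν (fun x t =>
      W x t + 2 * ν * Real.log (Real.sigmoid ((V x t - W x t) / (2 * ν)))) x t := by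
  have hexponent : ∀ a b : ℝ, -(a + 2 * ν * b) / (2 * ν) = -a / (2 * ν) - b := fun a b => by
    field_simp
    ring
  have hfactor : -V x t / (2 * ν) = -W x t / (2 * ν) + -((V x t - W x t) / (2 * ν)) := by ring
  simp only [coleHopf]
  rw [hexponent, Real.exp_sub, Real.exp_log (Real.sigmoid_pos _), Real.sigmoid_def, hfactor,
    Real.exp_add, div_inv_eq_mul]
  ring

namespace IsPotential

variable {ν : ℝ} {u v w U V W : ℝ → ℝ → ℝ} {x t : ℝ}

lemma hasDerivAt_fst (hU : IsPotential ν u U) (ht : 0 < t) :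
    HasDerivAt (fun y => U y t) (u x t) x := by
  have h := hU.hasFDerivAt x t ht
  simpa [h.fderiv] using hasDerivAt_slice_fst h.differentiableAt

lemma hasDerivAt_snd (hU : IsPotential ν u U) (ht : 0 < t) :
    HasDerivAt (fun τ => U x τ) (burgersRate ν u x t) t := by
  have h := hU.hasFDerivAt x t ht
  simpa [h.fderiv] using hasDerivAt_slice_snd h.differentiableAt

lemma isHeatSolution_coleHopf (hν : 0 < ν) (hU : IsPotential ν u U) :
    IsHeatSolution ν (coleHopf ν U) where
  equation x t ht := by
    have hx : ∀ y, HasDerivAt (fun y => coleHopf ν U y t)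
        (coleHopf ν U y t * (-u y t / (2 * ν))) y := fun y =>
      ((hU.hasDerivAt_fst ht).neg.div_const (2 * ν)).exp
    refine ⟨_, _, hx,
      (hx x).mul
        ((hasDerivAt_deriv_slice_fst isOpen_setOf_snd_pos hU.smooth ht).neg.div_const
          (2 * ν)), ?_⟩
    refine ((hU.hasDerivAt_snd ht).neg.div_const (2 * ν)).exp.congr_deriv ?_
    simp only [burgersRate, coleHopf, Pi.neg_apply]
    field_simp
    ring
  continuousOn := (hU.continuousOn.neg.div_const _).rexp
  growth T := by
    obtain ⟨C, hC⟩ := hU.growth T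
    refine ⟨Real.exp (C / (2 * ν)), C / (2 * ν), fun x t h0 hT => ?_⟩
    rw [coleHopf, Real.abs_exp, ← Real.exp_add, Real.exp_le_exp, div_mul_eq_mul_div, ← add_div]
    gcongr
    linarith [neg_abs_le (U x t), hC x t h0 hT]

lemma eq_of_initial_eq (hν : 0 < ν) (hU : IsPotential ν u U) (hV : IsPotential ν v V)
    (hinitial : ∀ x, U x 0 = V x 0) (ht : 0 ≤ t) : U x t = V x t :=
  (coleHopf_inj hν.ne').1 <| (hU.isHeatSolution_coleHopf hν).eq_of_initial_eq hν.le
    (hV.isHeatSolution_coleHopf hν) (fun x => (coleHopf_inj hν.ne').2 (hinitial x)) ht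

-- The Cole-Hopf transforms satisfy `coleHopf U = coleHopf V + coleHopf W`, a linear relation.
lemma eq_add_log_sigmoid (hν : 0 < ν) (hU : IsPotential ν u U) (hV : IsPotential ν v V)
    (hW : IsPotential ν w W)
    (hinitial : ∀ x, U x 0 = W x 0 + 2 * ν * Real.log (Real.sigmoid ((V x 0 - W x 0) / (2 * ν))))
    (ht : 0 ≤ t) :
    U x t = W x t + 2 * ν * Real.log (Real.sigmoid ((V x t - W x t) / (2 * ν))) := by
  refine (coleHopf_inj (V := fun x t =>
    W x t + 2 * ν * Real.log (Real.sigmoid ((V x t - W x t) / (2 * ν)))) hν.ne').1 ?_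
  rw [← coleHopf_add_coleHopf hν.ne']
  refine (hU.isHeatSolution_coleHopf hν).eq_of_initial_eq hν.le
    ((hV.isHeatSolution_coleHopf hν).add (hW.isHeatSolution_coleHopf hν)) (fun x => ?_) ht
  rw [coleHopf_add_coleHopf hν.ne']
  exact (coleHopf_inj hν.ne').2 (hinitial x)

lemma eq_add_sub_mul_sigmoid (hν : 0 < ν) (hU : IsPotential ν u U) (hV : IsPotential ν v V)
    (hW : IsPotential ν w W)
    (hinitial : ∀ x, U x 0 = W x 0 + 2 * ν * Real.log (Real.sigmoid ((V x 0 - W x 0) / (2 * ν))))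
    (ht : 0 < t) :
    u x t = w x t + (v x t - w x t) * Real.sigmoid (-((V x t - W x t) / (2 * ν))) := by
  have h := (hW.hasDerivAt_fst (x := x) ht).add <| ((hasDerivAt_log_sigmoid _).comp x
    (((hV.hasDerivAt_fst ht).sub (hW.hasDerivAt_fst ht)).div_const (2 * ν))).const_mul (2 * ν)
  rw [(hU.hasDerivAt_fst ht).unique (h.congr_of_eventuallyEq (Eventually.of_forall fun y =>
    hU.eq_add_log_sigmoid hν hV hW hinitial ht.le))]
  simp only [Pi.sub_apply]
  field_simp

lemma hasFDerivAt_sub (hU : IsPotential ν u U) (hV : IsPotential ν v V) (ht : 0 < t) :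
    HasFDerivAt (fun z : ℝ × ℝ => U z.1 z.2 - V z.1 z.2)
      ((u x t - v x t) • ContinuousLinearMap.fst ℝ ℝ ℝ
        + (burgersRate ν u x t - burgersRate ν v x t) • ContinuousLinearMap.snd ℝ ℝ ℝ) (x, t) := by
  refine ((hU.hasFDerivAt x t ht).sub (hV.hasFDerivAt x t ht)).congr_fderiv ?_
  module

lemma exists_abs_galilean_le (hU : IsPotential ν u U) (c p d T : ℝ) :
    ∃ C, ∀ x t, 0 ≤ t → t ≤ T →
      |U (x - c * t - p) t + (c * x - c ^ 2 / 2 * t + d)| ≤ C * (1 + |x|) := by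
  obtain ⟨C, hC⟩ := hU.growth T
  set A := |c| * |T| + |p|
  set D := |c| + c ^ 2 / 2 * |T| + |d| with hD
  refine ⟨|C| * (1 + A) + D, fun x t h0 hT => ?_⟩
  have htT : t ≤ |T| := hT.trans (le_abs_self T)
  have hshift : |x - c * t - p| ≤ |x| + A := by
    have hct : |c * t| ≤ |c| * |T| := by
      rw [abs_mul, abs_of_nonneg h0]
      gcongr
    linarith [abs_sub (x - c * t) p, abs_sub x (c * t)]
  have hlinear : |c * x - c ^ 2 / 2 * t + d| ≤ D * (1 + |x|) := by
    have hct : |c ^ 2 / 2 * t| ≤ c ^ 2 / 2 * |T| := by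
      rw [abs_of_nonneg (by positivity)]
      gcongr
    have hx : 0 ≤ (c ^ 2 / 2 * |T| + |d|) * |x| := by positivity
    have := abs_sub (c * x) (c ^ 2 / 2 * t)
    rw [abs_mul c x] at this
    rw [hD]
    linarith [abs_add_le (c * x - c ^ 2 / 2 * t) d, abs_nonneg c]
  calc |U (x - c * t - p) t + (c * x - c ^ 2 / 2 * t + d)|
      ≤ |U (x - c * t - p) t| + |c * x - c ^ 2 / 2 * t + d| := abs_add_le _ _
    _ ≤ |C| * (1 + (|x| + A)) + D * (1 + |x|) := by
      refine add_le_add ((hC _ t h0 hT).trans ?_) hlinear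
      gcongr
      exact le_abs_self C
    _ ≤ (|C| * (1 + A) + D) * (1 + |x|) := by
      have : 0 ≤ |C| * A * |x| := by positivity
      linarith

lemma hasFDerivAt_galilean (hU : IsPotential ν u U) (c p d : ℝ) (ht : 0 < t) :
    HasFDerivAt (fun z : ℝ × ℝ => U (z.1 - c * z.2 - p) z.2 + (c * z.1 - c ^ 2 / 2 * z.2 + d))
      ((u (x - c * t - p) t + c) • ContinuousLinearMap.fst ℝ ℝ ℝ
        + burgersRate ν (fun x t => u (x - c * t - p) t + c) x t • ContinuousLinearMap.snd ℝ ℝ ℝ)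
      (x, t) := by
  have hshift : HasFDerivAt (fun z : ℝ × ℝ => (z.1 - c * z.2 - p, z.2))
      ((ContinuousLinearMap.fst ℝ ℝ ℝ - c • ContinuousLinearMap.snd ℝ ℝ ℝ).prod
        (ContinuousLinearMap.snd ℝ ℝ ℝ)) (x, t) :=
    ((hasFDerivAt_fst.sub (hasFDerivAt_snd.const_mul c)).sub_const p).prodMk hasFDerivAt_snd
  have hderiv : deriv (fun y => u (y - c * t - p) t + c) x
      = deriv (fun y => u y t) (x - c * t - p) := by
    simp only [deriv_add_const, sub_sub]
    exact deriv_comp_sub_const (f := fun y => u y t) (c * t + p) x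
  refine (((hU.hasFDerivAt (x - c * t - p) t ht).comp (x, t) hshift).add
    (((hasFDerivAt_fst.const_mul c).sub
      (hasFDerivAt_snd.const_mul (c ^ 2 / 2))).add_const d)).congr_fderiv ?_
  ext
  · simp
  · simp only [burgersRate, hderiv, add_apply, ContinuousLinearMap.comp_apply,
      sub_apply, smul_apply,
      ContinuousLinearMap.prod_apply, ContinuousLinearMap.inr_apply, ContinuousLinearMap.coe_fst',
      ContinuousLinearMap.coe_snd', smul_eq_mul]
    ring

lemma galilean (hU : IsPotential ν u U) (c p d : ℝ) :
    IsPotential ν (fun x t => u (x - c * t - p) t + c)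
      (fun x t => U (x - c * t - p) t + (c * x - c ^ 2 / 2 * t + d)) where
  smooth := (hU.smooth.comp (f := fun z : ℝ × ℝ => (z.1 - c * z.2 - p, z.2))
    (by fun_prop) fun _ hz => hz).add contDiffOn_const
  hasFDerivAt _ _ ht := hU.hasFDerivAt_galilean c p d ht
  continuousOn := (hU.continuousOn.comp (f := fun z : ℝ × ℝ => (z.1 - c * z.2 - p, z.2))
    (by fun_prop) fun _ hz => hz).add (by fun_prop)
  growth := hU.exists_abs_galilean_le c p d

end IsPotential

lemma IsBoundedSolution.exists_isPotential {ν : ℝ} {u₀ : ℝ → ℝ} {u : ℝ → ℝ → ℝ}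
    (hu : IsBoundedSolution burgersFlux ν u₀ u) (hu₀ : MemLp u₀ ⊤ volume) {U₀ : ℝ → ℝ}
    (hU₀ : ∀ x, U₀ x = U₀ 0 + ∫ z in (0 : ℝ)..x, u₀ z) :
    ∃ U, IsPotential ν u U ∧ ∀ x, U x 0 = U₀ x := by
  have h := (hu.isPotential_potential hu₀).galilean 0 0 (U₀ 0)
  simp only [zero_mul, sub_zero, add_zero] at h
  refine ⟨_, h, fun x => ?_⟩
  rw [hU₀ x]
  simp [potential, hu.initial_value, add_comm]

lemma eq_zero_of_tendsto_of_tendsto_deriv {f f' : ℝ → ℝ} {a l : ℝ}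
    (hf : ∀ x, HasDerivAt f (f' x) x) (ha : Tendsto f atTop (𝓝 a))
    (hl : Tendsto f' atTop (𝓝 l)) : l = 0 := by
  have hmvt : ∀ x : ℝ, ∃ y ∈ Ioo x (x + 1), f' y = (f (x + 1) - f x) / (x + 1 - x) := fun x =>
    exists_hasDerivAt_eq_slope f f' (lt_add_one x)
      (fun y _ => (hf y).continuousAt.continuousWithinAt) (fun y _ => hf y)
  choose y hy hslope using hmvt
  have hy_top : Tendsto y atTop atTop := tendsto_atTop_mono (fun x => (hy x).1.le) tendsto_id
  have hdiff : Tendsto (fun x => f (x + 1) - f x) atTop (𝓝 0) := by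
    simpa using (ha.comp (tendsto_atTop_add_const_right _ 1 tendsto_id)).sub ha
  exact tendsto_nhds_unique (hl.comp hy_top) (hdiff.congr fun x => by simp [hslope])

lemma forall_pos_of_hasDerivAt_mul {y a : ℝ → ℝ} (ha : Continuous a)
    (hy : ∀ x, HasDerivAt y (a x * y x) x) (hpos : ∃ x, 0 < y x) (x : ℝ) : 0 < y x := by
  have hconst : ∀ x, HasDerivAt (fun x => y x * Real.exp (-∫ z in (0 : ℝ)..x, a z)) 0 x :=
    fun x => ((hy x).mul (ha.integral_hasStrictDerivAt 0 x).hasDerivAt.neg.exp).congr_deriv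
      (by simp only [Pi.neg_apply]; ring)
  obtain ⟨x', hx'⟩ := hpos
  have h := is_const_of_deriv_eq_zero (fun x => (hconst x).differentiableAt)
    (fun x => (hconst x).deriv) x x'
  exact (pos_iff_pos_of_mul_pos (h ▸ mul_pos hx' (Real.exp_pos _))).2 (Real.exp_pos _)

lemma shockSpeed_burgersFlux {ul ur : ℝ} (h : ul ≠ ur) :
    shockSpeed burgersFlux ul ur = (ul + ur) / 2 := by
  have : ul - ur ≠ 0 := sub_ne_zero.2 h
  unfold shockSpeed burgersFlux
  field_simp
  ring

lemma deriv_burgersFlux (v : ℝ) : deriv burgersFlux v = v := by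
  have h : HasDerivAt burgersFlux _ v := ((hasDerivAt_id v).pow 2).div_const 2
  simpa using h.deriv

namespace IsShockProfile

variable {ul ur : ℝ} {φ : ℝ → ℝ}

lemma hasDerivAt (h : ul ≠ ur) (hφ : IsShockProfile burgersFlux 1 ul ur φ) (x : ℝ) :
    HasDerivAt φ ((φ x - ul) * (φ x - ur) / 2) x := by
  have hd : ∀ x, HasDerivAt φ (deriv φ x) x := fun x =>
    (hφ.contDiff.differentiable two_ne_zero x).hasDerivAt
  have hconst : ∀ x, HasDerivAt (fun x => deriv φ x - (φ x - ul) * (φ x - ur) / 2) 0 x := by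
    intro x
    have hdd := (hφ.contDiff.differentiable_deriv_two x).hasDerivAt
    have heq := hφ.equation x
    rw [one_mul, shockSpeed_burgersFlux h, deriv_burgersFlux, iteratedDeriv_succ,
      iteratedDeriv_one] at heq
    exact (hdd.sub ((((hd x).sub_const ul).mul ((hd x).sub_const ur)).div_const 2)).congr_deriv
      (by linarith)
  obtain ⟨k, hk⟩ : ∃ k, ∀ x, deriv φ x = (φ x - ul) * (φ x - ur) / 2 + k :=
    ⟨deriv φ 0 - (φ 0 - ul) * (φ 0 - ur) / 2, fun x => by
      linarith [is_const_of_deriv_eq_zero (fun x => (hconst x).differentiableAt)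
        (fun x => (hconst x).deriv) x 0]⟩
  have hlim : Tendsto (deriv φ) atTop (𝓝 ((ur - ul) * (ur - ur) / 2 + k)) := by
    rw [funext hk]
    exact (((hφ.limit_right.sub_const ul).mul
      (hφ.limit_right.sub_const ur)).div_const 2).add_const _
  have hk0 := eq_zero_of_tendsto_of_tendsto_deriv hd hφ.limit_right hlim
  exact (hd x).congr_deriv (by linarith [hk x])

lemma mem_Ioo (h : ur < ul) (hφ : IsShockProfile burgersFlux 1 ul ur φ) (x : ℝ) :
    φ x ∈ Ioo ur ul := by
  have hd := hφ.hasDerivAt h.ne'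
  have hc : Continuous φ := continuous_iff_continuousAt.2 fun x => (hd x).continuousAt
  have hlower := forall_pos_of_hasDerivAt_mul (y := fun x => φ x - ur)
    (a := fun x => (φ x - ul) / 2) (by fun_prop)
    (fun x => ((hd x).sub_const ur).congr_deriv (by ring))
    ((hφ.limit_left.eventually (lt_mem_nhds h)).exists.imp fun x => sub_pos.2) x
  have hupper := forall_pos_of_hasDerivAt_mul (y := fun x => ul - φ x)
    (a := fun x => (φ x - ur) / 2) (by fun_prop)
    (fun x => ((hd x).const_sub ul).congr_deriv (by ring))
    ((hφ.limit_right.eventually (gt_mem_nhds h)).exists.imp fun x => sub_pos.2) x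
  exact ⟨sub_pos.1 hlower, sub_pos.1 hupper⟩

-- The quotient `(φ - ur) / (ul - φ)` has constant logarithmic derivative `-(ul - ur) / 2`.
lemma exists_weight_eq_sigmoid {ν : ℝ} (hν : ν ≠ 0) (h : ur < ul)
    (hφ : IsShockProfile burgersFlux 1 ul ur φ) :
    ∃ x₀, ∀ x, weight φ ν ul ur x = Real.sigmoid (-((ul - ur) / (2 * ν) * (x - x₀))) := by
  have hlower : ∀ x, 0 < φ x - ur := fun x => sub_pos.2 (hφ.mem_Ioo h x).1
  have hupper : ∀ x, 0 < ul - φ x := fun x => sub_pos.2 (hφ.mem_Ioo h x).2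
  have hlog : ∀ x, HasDerivAt
      (fun x => Real.log (φ x - ur) - Real.log (ul - φ x) + (ul - ur) / 2 * x) 0 x := fun x => by
    have hd := hφ.hasDerivAt h.ne' x
    refine ((((hd.sub_const ur).log (hlower x).ne').sub
      ((hd.const_sub ul).log (hupper x).ne')).add (hasDerivAt_const_mul _)).congr_deriv ?_
    field_simp [(hlower x).ne', (hupper x).ne']
    ring
  obtain ⟨a, ha⟩ : ∃ a, ∀ x, Real.log (φ x - ur) - Real.log (ul - φ x)
      = -((ul - ur) / 2 * (x - a)) :=
    ⟨(Real.log (φ 0 - ur) - Real.log (ul - φ 0)) / ((ul - ur) / 2), fun x => by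
      have hconst := is_const_of_deriv_eq_zero (fun x => (hlog x).differentiableAt)
        (fun x => (hlog x).deriv) x 0
      rw [mul_sub, mul_div_cancel₀ _ (by linarith)]
      linarith⟩
  refine ⟨ν * a, fun x => ?_⟩
  have hscale : (ul - ur) / (2 * ν) * (x - ν * a) = (ul - ur) / 2 * (x / ν - a) := by
    field_simp
  have hratio : Real.exp ((ul - ur) / 2 * (x / ν - a)) = (ul - φ (x / ν)) / (φ (x / ν) - ur) := by
    rw [← neg_neg (_ * _), ← ha, neg_sub, Real.exp_sub, Real.exp_log (hupper _),
      Real.exp_log (hlower _)]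
  rw [hscale, Real.sigmoid_def, neg_neg, hratio, weight, scaledProfile, one_add_div (hlower _).ne',
    inv_div]
  congr 1
  ring

end IsShockProfile

/-- The decreasing logistic front of steepness `β` centred at `x₀`; the weight of a shock profile
is of this form. -/
noncomputable def logisticFront (β x₀ x : ℝ) : ℝ := Real.sigmoid (-(β * (x - x₀)))

section LogisticFront

variable {β x₀ : ℝ}

lemma hasDerivAt_logisticFront (x : ℝ) :
    HasDerivAt (logisticFront β x₀)
      (-(β * (logisticFront β x₀ x * (1 - logisticFront β x₀ x)))) x := by
  have hexponent : HasDerivAt (fun x => -(β * (x - x₀))) (-(β * 1)) x :=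
    (((hasDerivAt_id x).sub_const x₀).const_mul β).neg
  exact ((Real.hasDerivAt_sigmoid _).comp x hexponent).congr_deriv (by
    rw [logisticFront]; ring)

lemma deriv_logisticFront :
    deriv (logisticFront β x₀) =
      fun x => -(β * (logisticFront β x₀ x * (1 - logisticFront β x₀ x))) :=
  funext fun x => (hasDerivAt_logisticFront x).deriv

lemma logisticFront_pos (x : ℝ) : 0 < logisticFront β x₀ x := Real.sigmoid_pos _

lemma logisticFront_lt_one (x : ℝ) : logisticFront β x₀ x < 1 := Real.sigmoid_lt_one _

lemma continuous_logisticFront : Continuous (logisticFront β x₀) :=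
  continuous_iff_continuousAt.2 fun x => (hasDerivAt_logisticFront x).continuousAt

lemma continuous_deriv_logisticFront : Continuous (deriv (logisticFront β x₀)) := by
  have := continuous_logisticFront (β := β) (x₀ := x₀)
  rw [deriv_logisticFront]
  fun_prop

lemma deriv_logisticFront_neg (hβ : 0 < β) (x : ℝ) : deriv (logisticFront β x₀) x < 0 := by
  rw [deriv_logisticFront]
  exact neg_lt_zero.2 (mul_pos hβ
    (mul_pos (logisticFront_pos x) (sub_pos.2 (logisticFront_lt_one x))))

lemma tendsto_logisticFront_atTop (hβ : 0 < β) : Tendsto (logisticFront β x₀) atTop (𝓝 0) :=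
  Real.tendsto_sigmoid_atBot.comp <| tendsto_neg_atTop_atBot.comp <|
    (tendsto_atTop_add_const_right _ (-x₀) tendsto_id).const_mul_atTop hβ

lemma tendsto_logisticFront_atBot (hβ : 0 < β) : Tendsto (logisticFront β x₀) atBot (𝓝 1) :=
  Real.tendsto_sigmoid_atTop.comp <| tendsto_neg_atBot_atTop.comp <|
    (tendsto_atBot_add_const_right _ (-x₀) tendsto_id).const_mul_atBot hβ

lemma integrable_deriv_logisticFront (hβ : 0 < β) :
    Integrable (deriv (logisticFront β x₀)) := by
  refine integrable_of_intervalIntegral_norm_bounded 1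
    (fun r => continuous_deriv_logisticFront.integrableOn_Ioc) tendsto_neg_atTop_atBot tendsto_id
    (Eventually.of_forall fun r => ?_)
  simp only [id_eq, Real.norm_of_nonpos (deriv_logisticFront_neg hβ _).le,
    intervalIntegral.integral_neg]
  rw [intervalIntegral.integral_eq_sub_of_hasDerivAt
    (fun x _ => (hasDerivAt_logisticFront x).differentiableAt.hasDerivAt)
    (continuous_deriv_logisticFront.intervalIntegrable _ _)]
  linarith [logisticFront_pos (β := β) (x₀ := x₀) r, logisticFront_lt_one (β := β) (x₀ := x₀) (-r)]

lemma integral_deriv_logisticFront (hβ : 0 < β) : ∫ x, deriv (logisticFront β x₀) x = -1 := by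
  rw [integral_of_hasDerivAt_of_tendsto
    (fun x => (hasDerivAt_logisticFront x).differentiableAt.hasDerivAt)
    (integrable_deriv_logisticFront hβ) (tendsto_logisticFront_atBot hβ)
    (tendsto_logisticFront_atTop hβ), zero_sub]

lemma hasDerivAt_deriv_logisticFront (x : ℝ) :
    HasDerivAt (deriv (logisticFront β x₀)) (iteratedDeriv 2 (logisticFront β x₀) x) x := by
  rw [iteratedDeriv_succ, iteratedDeriv_one]
  refine DifferentiableAt.hasDerivAt ?_
  rw [deriv_logisticFront]
  have h := (hasDerivAt_logisticFront (β := β) (x₀ := x₀) x).differentiableAt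
  fun_prop

lemma iteratedDeriv_two_logisticFront (x : ℝ) :
    iteratedDeriv 2 (logisticFront β x₀) x
      = deriv (logisticFront β x₀) x * (β * (2 * logisticFront β x₀ x - 1)) := by
  have h := (hasDerivAt_logisticFront (β := β) (x₀ := x₀) x)
  refine (hasDerivAt_deriv_logisticFront x).unique ?_
  simp only [deriv_logisticFront]
  exact ((h.mul (h.const_sub 1)).const_mul β).neg.congr_deriv (by ring)

lemma integrable_iteratedDeriv_two_logisticFront (hβ : 0 < β) :
    Integrable (iteratedDeriv 2 (logisticFront β x₀)) := by
  rw [funext iteratedDeriv_two_logisticFront]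
  have := continuous_logisticFront (β := β) (x₀ := x₀)
  refine (integrable_deriv_logisticFront hβ).mul_bdd (c := β)
    (by fun_prop) (Eventually.of_forall fun x => ?_)
  rw [Real.norm_eq_abs, abs_mul, abs_of_pos hβ]
  refine mul_le_of_le_one_right hβ.le (abs_le.2 ⟨?_, ?_⟩)
  · linarith [logisticFront_pos (β := β) (x₀ := x₀) x]
  · linarith [logisticFront_lt_one (β := β) (x₀ := x₀) x]

end LogisticFront

lemma exists_bound_of_periodic {f : ℝ → ℝ → ℝ} {p : ℝ} (hp : 0 < p)
    (hf : ContinuousOn (fun z : ℝ × ℝ => f z.1 z.2) {z : ℝ × ℝ | 0 < z.2})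
    (hper : ∀ t, 0 < t → Function.Periodic (fun x => f x t) p) {t₁ : ℝ} (ht₁ : 0 < t₁) (t₂ : ℝ) :
    ∃ C, ∀ x, ∀ t ∈ Icc t₁ t₂, |f x t| ≤ C := by
  obtain ⟨C, hC⟩ := ((isCompact_Icc (a := (0 : ℝ)) (b := p)).prod
    (isCompact_Icc (a := t₁) (b := t₂))).exists_bound_of_continuousOn
    (hf.mono fun z hz => ht₁.trans_le hz.2.1)
  refine ⟨C, fun x t ht => ?_⟩
  obtain ⟨y, hy, hxy⟩ := (hper t (ht₁.trans_le ht.1)).exists_mem_Ico₀ hp x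
  have hyt := hC (y, t) ⟨⟨hy.1, hy.2.le⟩, ht⟩
  rwa [← hxy] at hyt

lemma periodic_deriv {f : ℝ → ℝ} {p : ℝ} (h : Function.Periodic f p) :
    Function.Periodic (deriv f) p := fun x => by
  rw [← deriv_comp_add_const, h.funext]

lemma burgersRate_periodic {ν p t : ℝ} {v : ℝ → ℝ → ℝ}
    (h : Function.Periodic (fun x => v x t) p) :
    Function.Periodic (fun x => burgersRate ν v x t) p := fun x => by
  simp only [burgersRate, periodic_deriv h x, h x]

namespace IsPotential

variable {ν p r t : ℝ} {u U : ℝ → ℝ → ℝ}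

lemma quasiPeriodic (hν : 0 < ν) (hU : IsPotential ν u U)
    (hinitial : Function.Periodic (fun x => U x 0 - r * x) p) (ht : 0 ≤ t) :
    Function.Periodic (fun x => U x t - r * x) p := by
  have hshift := hU.galilean 0 (-p) (-(r * p))
  simp only [zero_mul, sub_zero, sub_neg_eq_add, add_zero, zero_add, ne_eq, OfNat.ofNat_ne_zero,
    not_false_eq_true, zero_pow, zero_div] at hshift
  intro x
  have h := hshift.eq_of_initial_eq hν hU (fun x => by linarith [hinitial x]) ht (x := x)
  simp only
  linarith

lemma periodic (hU : IsPotential ν u U) (h : Function.Periodic (fun x => U x t - r * x) p)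
    (ht : 0 < t) : Function.Periodic (fun x => u x t) p := by
  have hd : ∀ x, HasDerivAt (fun x => U x t - r * x) (u x t - r) x := fun x =>
    (hU.hasDerivAt_fst ht).sub (hasDerivAt_const_mul r)
  intro x
  have hshift := (hd (x + p)).comp_add_const x p
  rw [h.funext] at hshift
  exact sub_left_injective (hshift.unique (hd x))

end IsPotential

/-- A front of Burgers' equation with viscosity `ν` between `p`-periodic states, in terms of
potentials: `uL` and `uR` are solutions of means `ul` and `ur` whose potentials `UL` and `UR`
differ by a Galilean boost, and `u` is their nonlinear superposition. The constant `x₀` is the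
position of the front at time `0`. -/
structure IsPeriodicFront (ν p ul ur x₀ : ℝ) (u uL uR UL UR : ℝ → ℝ → ℝ) : Prop where
  potential_left : IsPotential ν uL UL
  potential_right : IsPotential ν uR UR
  superposition : ∀ x t, 0 < t →
    u x t = uR x t + (uL x t - uR x t) * Real.sigmoid (-((UL x t - UR x t) / (2 * ν)))
  galilean : ∀ x t, 0 ≤ t →
    UL x t = UR (x - (ul - ur) * t) t + ((ul - ur) * (x - x₀) - (ul - ur) ^ 2 / 2 * t)
  quasiPeriodic_left : ∀ t, 0 ≤ t → Function.Periodic (fun x => UL x t - ul * x) p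
  quasiPeriodic_right : ∀ t, 0 ≤ t → Function.Periodic (fun x => UR x t - ur * x) p

lemma periodic_primitive {w : ℝ → ℝ} {p : ℝ} (hper : Function.Periodic w p)
    (hw : ∀ a b, IntervalIntegrable w volume a b) (havg : ∫ x in (0 : ℝ)..p, w x = 0) :
    Function.Periodic (fun x => ∫ z in (0 : ℝ)..x, w z) p := fun x => by
  have h := hper.intervalIntegral_add_eq_add 0 x hw
  rwa [zero_add, havg, add_zero] at h

section Existence

variable {ν p ul ur x₀ : ℝ} {w₀ : ℝ → ℝ} {u uL uR : ℝ → ℝ → ℝ}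

lemma intervalIntegrable_of_memLp_top (hw : MemLp w₀ ⊤ volume) (a b : ℝ) :
    IntervalIntegrable w₀ volume a b :=
  (hw.locallyIntegrable le_top).integrableOn_isCompact isCompact_uIcc |>.intervalIntegrable

lemma IsBoundedSolution.exists_isPotential_add {V₀ v₀ : ℝ → ℝ}
    (hu : IsBoundedSolution burgersFlux ν (fun x => v₀ x + w₀ x) u) (hw : MemLp w₀ ⊤ volume)
    (hV₀ : ∀ x, HasDerivAt V₀ (v₀ x) x) (hv₀ : Continuous v₀) (hbound : ∃ C, ∀ x, ‖v₀ x‖ ≤ C) :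
    ∃ U, IsPotential ν u U ∧ ∀ x, U x 0 = V₀ x + ∫ z in (0 : ℝ)..x, w₀ z := by
  obtain ⟨C, hC⟩ := hbound
  refine hu.exists_isPotential
    ((memLp_top_of_bound hv₀.aestronglyMeasurable C (Eventually.of_forall hC)).add hw) fun x => ?_
  have hi := hv₀.intervalIntegrable (μ := volume) 0 x
  rw [intervalIntegral.integral_add hi (intervalIntegrable_of_memLp_top hw _ _),
    intervalIntegral.integral_eq_sub_of_hasDerivAt (fun z _ => hV₀ z) hi,
    intervalIntegral.integral_same]
  ring

lemma hasDerivAt_log_sigmoid_mul_sub (β : ℝ) (x : ℝ) :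
    HasDerivAt (fun x => Real.log (Real.sigmoid (β * (x - x₀)))) (β * logisticFront β x₀ x) x := by
  have hexponent : HasDerivAt (fun x => β * (x - x₀)) (β * 1) x :=
    ((hasDerivAt_id x).sub_const x₀).const_mul β
  exact ((hasDerivAt_log_sigmoid _).comp x hexponent).congr_deriv (by
    rw [logisticFront]; ring)

-- With `β = (ul - ur) / (2 * ν)` the data of `u` are the derivative of
-- `UR + 2 * ν * log (sigmoid (β * (x - x₀)))`, and `UL - UR = (ul - ur) * (x - x₀)` initially.
lemma exists_isPeriodicFront (hν : 0 < ν) (hw : MemLp w₀ ⊤ volume)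
    (hper : Function.Periodic w₀ p) (havg : ∫ x in (0 : ℝ)..p, w₀ x = 0)
    (hu : IsBoundedSolution burgersFlux ν
      (fun x => ur + (ul - ur) * logisticFront ((ul - ur) / (2 * ν)) x₀ x + w₀ x) u)
    (hL : IsBoundedSolution burgersFlux ν (fun x => ul + w₀ x) uL)
    (hR : IsBoundedSolution burgersFlux ν (fun x => ur + w₀ x) uR) :
    ∃ UL UR, IsPeriodicFront ν p ul ur x₀ u uL uR UL UR := by
  set β := (ul - ur) / (2 * ν)
  have hβ : 2 * ν * β = ul - ur := mul_div_cancel₀ _ (by positivity)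
  have hperW := periodic_primitive hper (intervalIntegrable_of_memLp_top hw) havg
  obtain ⟨UL, hUL, hUL₀⟩ := hL.exists_isPotential_add (V₀ := fun x => ul * x - (ul - ur) * x₀) hw
    (fun x => (hasDerivAt_const_mul ul).sub_const _) continuous_const ⟨_, fun _ => le_rfl⟩
  obtain ⟨UR, hUR, hUR₀⟩ := hR.exists_isPotential_add (V₀ := fun x => ur * x) hw
    (fun x => hasDerivAt_const_mul ur) continuous_const ⟨_, fun _ => le_rfl⟩
  obtain ⟨U, hU, hU₀⟩ := hu.exists_isPotential_add
    (V₀ := fun x => ur * x + 2 * ν * Real.log (Real.sigmoid (β * (x - x₀)))) hw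
    (fun x => ((hasDerivAt_const_mul ur).add
      ((hasDerivAt_log_sigmoid_mul_sub β x).const_mul (2 * ν))).congr_deriv (by
        rw [← hβ]; ring))
    ((continuous_logisticFront.const_mul _).const_add _)
    ⟨|ur| + |ul - ur|, fun x => (norm_add_le _ _).trans <| by
      rw [norm_mul, Real.norm_of_nonneg (logisticFront_pos x).le]
      exact add_le_add_right (mul_le_of_le_one_right (norm_nonneg _) (logisticFront_lt_one x).le) _⟩
  have hgap : ∀ x, UL x 0 - UR x 0 = (ul - ur) * (x - x₀) := fun x => by
    rw [hUL₀, hUR₀]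
    ring
  refine ⟨UL, UR, hUL, hUR, fun x t => hU.eq_add_sub_mul_sigmoid hν hUL hUR fun x => ?_,
    fun x t ht => ?_, fun t => hUL.quasiPeriodic hν fun x => ?_,
    fun t => hUR.quasiPeriodic hν fun x => ?_⟩
  · rw [hU₀, hgap, hUR₀, mul_div_right_comm]
    ring
  · rw [hUL.eq_of_initial_eq hν (hUR.galilean (ul - ur) 0 (-((ul - ur) * x₀))) (fun x => ?_) ht,
      sub_zero]
    · ring
    · simp only [mul_zero, sub_zero]
      linarith [hgap x]
  · linarith [hUL₀ x, hUL₀ (x + p), hperW x]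
  · linarith [hUR₀ x, hUR₀ (x + p), hperW x]

end Existence

namespace IsPeriodicFront

variable {ν p ul ur x₀ x t : ℝ} {u uL uR UL UR : ℝ → ℝ → ℝ}

-- After a time `t` with `(ul - ur) * t = k * p` the boost relating `UL` to `UR` is a translation
-- by `k` periods.
lemma sub_eq_of_mul_eq_nat_mul (h : IsPeriodicFront ν p ul ur x₀ u uL uR UL UR) (ht : 0 ≤ t)
    {k : ℕ} (hk : (ul - ur) * t = k * p) :
    UL x t - UR x t = (ul - ur) * (x - (ul + ur) / 2 * t - x₀) := by
  have hperiod : UR (x - (ul - ur) * t) t - ur * (x - (ul - ur) * t) = UR x t - ur * x :=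
    hk ▸ (h.quasiPeriodic_right t ht).sub_nat_mul_eq k
  linear_combination h.galilean x t ht + hperiod

lemma eq_ansatz_of_mul_eq_nat_mul (h : IsPeriodicFront ν p ul ur x₀ u uL uR UL UR) (ht : 0 < t)
    {k : ℕ} (hk : (ul - ur) * t = k * p) :
    u x t = ansatz uL uR (logisticFront ((ul - ur) / (2 * ν)) x₀) ((ul + ur) / 2 * t) x t := by
  rw [h.superposition x t ht, h.sub_eq_of_mul_eq_nat_mul ht.le hk, ansatz, logisticFront,
    mul_div_right_comm]
  ring

end IsPeriodicFront

section SigmoidComparison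

lemma sigmoid_le_exp_abs_sub_mul (a b : ℝ) :
    Real.sigmoid a ≤ Real.exp |a - b| * Real.sigmoid b := by
  have hone : 1 ≤ Real.exp |a - b| := Real.one_le_exp (abs_nonneg _)
  have hexp : Real.exp (-b) ≤ Real.exp |a - b| * Real.exp (-a) := by
    rw [← Real.exp_add, Real.exp_le_exp]
    linarith [le_abs_self (a - b)]
  rw [Real.sigmoid_def, Real.sigmoid_def, ← div_eq_mul_inv, inv_eq_one_div,
    div_le_div_iff₀ (by positivity) (by positivity)]
  linarith

lemma abs_sigmoid_sub_sigmoid_le (a b : ℝ) :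
    |Real.sigmoid a - Real.sigmoid b|
      ≤ Real.exp |a - b| * (Real.sigmoid b * (1 - Real.sigmoid b)) := by
  have hneg := sigmoid_le_exp_abs_sub_mul (-a) (-b)
  rw [neg_sub_neg, abs_sub_comm b a, Real.sigmoid_neg, Real.sigmoid_neg] at hneg
  have hpos := sigmoid_le_exp_abs_sub_mul a b
  refine abs_le.2 ⟨?_, ?_⟩
  · nlinarith [Real.sigmoid_pos a, Real.sigmoid_lt_one a, Real.sigmoid_pos b, Real.sigmoid_lt_one b]
  · nlinarith [Real.sigmoid_pos a, Real.sigmoid_lt_one a, Real.sigmoid_pos b, Real.sigmoid_lt_one b]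

variable {β a B : ℝ} {θ θ' : ℝ → ℝ}

lemma integrable_sigmoid_sub_logisticFront (hβ : 0 < β) (hθ : Continuous θ)
    (hB : ∀ x, |θ x - β * (x - a)| ≤ B) :
    Integrable fun x => Real.sigmoid (-θ x) - logisticFront β a x := by
  have hfront := continuous_logisticFront (β := β) (x₀ := a)
  refine ((integrable_deriv_logisticFront (x₀ := a) hβ).const_mul (-(Real.exp B / β))).mono'
    ((continuous_sigmoid.comp hθ.neg).sub hfront).aestronglyMeasurable
    (Eventually.of_forall fun x => ?_)
  have hx := abs_sigmoid_sub_sigmoid_le (-θ x) (-(β * (x - a)))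
  rw [neg_sub_neg, abs_sub_comm (β * (x - a))] at hx
  refine hx.trans ?_
  rw [deriv_logisticFront, neg_mul_neg, ← mul_assoc (_ / β), div_mul_cancel₀ _ hβ.ne',
    logisticFront]
  gcongr
  · exact mul_nonneg (Real.sigmoid_nonneg _) (sub_nonneg.2 (Real.sigmoid_le_one _))
  · exact hB x

lemma tendsto_log_sigmoid_atTop :
    Tendsto (fun y => Real.log (Real.sigmoid y)) atTop (𝓝 0) := by
  simpa using Real.tendsto_sigmoid_atTop.log one_ne_zero

lemma log_sigmoid_eq_add (y : ℝ) :
    Real.log (Real.sigmoid y) = y + Real.log (Real.sigmoid (-y)) := by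
  rw [← Real.sigmoid_mul_rexp_neg, Real.log_mul (Real.sigmoid_pos y).ne' (Real.exp_pos _).ne',
    Real.log_exp]
  ring

/-- The primitive used to compare the profile `sigmoid (-θ)` with the logistic front
`sigmoid (-η)`, where `η x = β * (x - a)`: the difference of `log (sigmoid θ)` and
`log (sigmoid η)`, corrected so as to vanish at both ends when `θ - η` is bounded. -/
noncomputable def logSigmoidGap (β a : ℝ) (θ : ℝ → ℝ) (x : ℝ) : ℝ :=
  Real.log (Real.sigmoid (θ x)) - Real.log (Real.sigmoid (β * (x - a)))
    - (θ x - β * (x - a)) * logisticFront β a x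

lemma hasDerivAt_logSigmoidGap {x θ'x : ℝ} (hθ : HasDerivAt θ θ'x x) :
    HasDerivAt (logSigmoidGap β a θ)
      (θ'x * (Real.sigmoid (-θ x) - logisticFront β a x)
        - (θ x - β * (x - a)) * deriv (logisticFront β a) x) x := by
  have hgap : HasDerivAt (fun x => θ x - β * (x - a)) (θ'x - β * 1) x :=
    hθ.sub (((hasDerivAt_id x).sub_const a).const_mul β)
  exact ((((hasDerivAt_log_sigmoid _).comp x hθ).sub
    (hasDerivAt_log_sigmoid_mul_sub β x)).sub (hgap.mul
      (hasDerivAt_logisticFront x).differentiableAt.hasDerivAt)).congr_deriv (by ring)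

lemma tendsto_logSigmoidGap_atTop (hβ : 0 < β) (hB : ∀ x, |θ x - β * (x - a)| ≤ B) :
    Tendsto (logSigmoidGap β a θ) atTop (𝓝 0) := by
  have hη : Tendsto (fun x => β * (x - a)) atTop atTop :=
    (tendsto_atTop_add_const_right _ (-a) tendsto_id).const_mul_atTop hβ
  have hθ : Tendsto θ atTop atTop :=
    tendsto_atTop_mono (fun x => by linarith [(abs_le.1 (hB x)).1])
      (tendsto_atTop_add_const_right _ (-B) hη)
  have hprod : Tendsto (fun x => (θ x - β * (x - a)) * logisticFront β a x) atTop (𝓝 0) :=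
    bdd_le_mul_tendsto_zero' B (Eventually.of_forall hB) (tendsto_logisticFront_atTop hβ)
  have h := ((tendsto_log_sigmoid_atTop.comp hθ).sub (tendsto_log_sigmoid_atTop.comp hη)).sub hprod
  rw [sub_zero, sub_zero] at h
  exact h

lemma tendsto_logSigmoidGap_atBot (hβ : 0 < β) (hB : ∀ x, |θ x - β * (x - a)| ≤ B) :
    Tendsto (logSigmoidGap β a θ) atBot (𝓝 0) := by
  have hη : Tendsto (fun x => -(β * (x - a))) atBot atTop :=
    tendsto_neg_atBot_atTop.comp
      ((tendsto_atBot_add_const_right _ (-a) tendsto_id).const_mul_atBot hβ)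
  have hθ : Tendsto (fun x => -θ x) atBot atTop :=
    tendsto_atTop_mono (fun x => by linarith [(abs_le.1 (hB x)).2])
      (tendsto_atTop_add_const_right _ (-B) hη)
  have hprod : Tendsto (fun x => (θ x - β * (x - a)) * (1 - logisticFront β a x)) atBot (𝓝 0) :=
    bdd_le_mul_tendsto_zero' B (Eventually.of_forall hB)
      (by simpa using (tendsto_logisticFront_atBot hβ).const_sub 1)
  have h := ((tendsto_log_sigmoid_atTop.comp hθ).sub (tendsto_log_sigmoid_atTop.comp hη)).add hprod
  simp only [sub_zero, add_zero] at h
  refine h.congr fun x => ?_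
  rw [logSigmoidGap, log_sigmoid_eq_add (θ x), log_sigmoid_eq_add (β * (x - a))]
  simp only [Function.comp_apply]
  ring

lemma integral_mul_sigmoid_sub_logisticFront {M : ℝ} (hβ : 0 < β)
    (hθ : ∀ x, HasDerivAt θ (θ' x) x) (hθ' : Continuous θ') (hM : ∀ x, |θ' x| ≤ M)
    (hB : ∀ x, |θ x - β * (x - a)| ≤ B) :
    ∫ x, θ' x * (Real.sigmoid (-θ x) - logisticFront β a x)
      = ∫ x, (θ x - β * (x - a)) * deriv (logisticFront β a) x := by
  have hcont : Continuous θ := continuous_iff_continuousAt.2 fun x => (hθ x).continuousAt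
  have hleft := (integrable_sigmoid_sub_logisticFront hβ hcont hB).bdd_mul
    hθ'.aestronglyMeasurable (Eventually.of_forall hM)
  have hright := (integrable_deriv_logisticFront (x₀ := a) hβ).bdd_mul
    (f := fun x => θ x - β * (x - a)) (by fun_prop) (Eventually.of_forall hB)
  rw [← sub_eq_zero, ← integral_sub hleft hright, ← sub_zero (0 : ℝ)]
  exact integral_of_hasDerivAt_of_tendsto (fun x => hasDerivAt_logSigmoidGap (hθ x))
    (hleft.sub hright) (tendsto_logSigmoidGap_atBot hβ hB) (tendsto_logSigmoidGap_atTop hβ hB)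

lemma integral_mul_sigmoid_div_sub_logisticFront {c κ M : ℝ} (hc : 0 < c) (hκ : 0 < κ)
    (hθ : ∀ x, HasDerivAt θ (θ' x) x) (hθ' : Continuous θ') (hM : ∀ x, |θ' x| ≤ M)
    (hB : ∀ x, |θ x - c * (x - a)| ≤ B) :
    ∫ x, θ' x * (Real.sigmoid (-(θ x / κ)) - logisticFront (c / κ) a x)
      = ∫ x, (θ x - c * (x - a)) * deriv (logisticFront (c / κ) a) x := by
  have hscaled := integral_mul_sigmoid_sub_logisticFront (M := M / κ) (B := B / κ) (a := a)
    (div_pos hc hκ) (fun x => (hθ x).div_const κ) (hθ'.div_const κ)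
    (fun x => by rw [abs_div, abs_of_pos hκ]; gcongr; exact hM x)
    (fun x => by
      rw [div_mul_eq_mul_div, ← sub_div, abs_div, abs_of_pos hκ]
      gcongr
      exact hB x)
  simp only [div_mul_eq_mul_div (_ : ℝ) κ, ← sub_div, integral_div] at hscaled
  exact (div_left_inj' hκ.ne').1 hscaled

end SigmoidComparison

lemma logisticFront_sub (β x₀ ξ x : ℝ) :
    logisticFront β x₀ (x - ξ) = logisticFront β (x₀ + ξ) x := by
  rw [logisticFront, logisticFront, sub_sub, add_comm ξ]

/-- The mass of `u - ψ_ξ` at a time `t > 0`, for a periodic front `u` and the ansatz `ψ_ξ` built on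
the logistic front, expressed through the potentials (see `IsPeriodicFront.integral_sub_ansatz`).
Unlike `∫ (u - ψ_ξ)` it is visibly differentiable in `ξ` and `t`. -/
noncomputable def excessMass (ν ul ur x₀ : ℝ) (UL UR : ℝ → ℝ → ℝ) (ξ t : ℝ) : ℝ :=
  ∫ y, (UL (y + ξ) t - UR (y + ξ) t - (ul - ur) * (y - x₀))
    * deriv (logisticFront ((ul - ur) / (2 * ν)) x₀) y

namespace IsPeriodicFront

variable {ν p ul ur x₀ t : ℝ} {u uL uR UL UR : ℝ → ℝ → ℝ}

lemma periodic_left (h : IsPeriodicFront ν p ul ur x₀ u uL uR UL UR) (ht : 0 < t) :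
    Function.Periodic (fun x => uL x t) p :=
  h.potential_left.periodic (h.quasiPeriodic_left t ht.le) ht

lemma periodic_right (h : IsPeriodicFront ν p ul ur x₀ u uL uR UL UR) (ht : 0 < t) :
    Function.Periodic (fun x => uR x t) p :=
  h.potential_right.periodic (h.quasiPeriodic_right t ht.le) ht

lemma continuous_sub (h : IsPeriodicFront ν p ul ur x₀ u uL uR UL UR) (ht : 0 < t) :
    Continuous fun x => uL x t - uR x t :=
  (continuous_slice_fst h.potential_left.smooth.continuousOn ht).sub
    (continuous_slice_fst h.potential_right.smooth.continuousOn ht)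

lemma hasDerivAt_gap (h : IsPeriodicFront ν p ul ur x₀ u uL uR UL UR) (ht : 0 < t) (x : ℝ) :
    HasDerivAt (fun x => UL x t - UR x t) (uL x t - uR x t) x :=
  (h.potential_left.hasDerivAt_fst ht).sub (h.potential_right.hasDerivAt_fst ht)

lemma continuous_gap (h : IsPeriodicFront ν p ul ur x₀ u uL uR UL UR) (ht : 0 < t) :
    Continuous fun x => UL x t - UR x t :=
  continuous_iff_continuousAt.2 fun x => (h.hasDerivAt_gap ht x).continuousAt

lemma exists_bound_gap (h : IsPeriodicFront ν p ul ur x₀ u uL uR UL UR) (hp : p ≠ 0) (ht : 0 < t)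
    (a : ℝ) : ∃ C, ∀ x, |UL x t - UR x t - (ul - ur) * (x - a)| ≤ C := by
  have hper : Function.Periodic (fun x => UL x t - UR x t - (ul - ur) * (x - a)) p := fun x => by
    have hL := h.quasiPeriodic_left t ht.le x
    have hR := h.quasiPeriodic_right t ht.le x
    simp only at hL hR
    linarith
  obtain ⟨C, hC⟩ := (hper.isBounded_of_continuous hp
    ((h.continuous_gap ht).sub (by fun_prop))).exists_norm_le
  exact ⟨C, fun x => hC _ (mem_range_self x)⟩

lemma integrable_excessMass (hν : 0 < ν) (hu : ur < ul) (hp : p ≠ 0)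
    (h : IsPeriodicFront ν p ul ur x₀ u uL uR UL UR) (ht : 0 < t) (ξ : ℝ) :
    Integrable fun y => (UL (y + ξ) t - UR (y + ξ) t - (ul - ur) * (y - x₀))
      * deriv (logisticFront ((ul - ur) / (2 * ν)) x₀) y := by
  obtain ⟨C, hC⟩ := h.exists_bound_gap hp ht (x₀ + ξ)
  refine (integrable_deriv_logisticFront (div_pos (sub_pos.2 hu) (by positivity))).bdd_mul (c := C)
    (((h.continuous_gap ht).comp (continuous_add_const ξ)).sub (by fun_prop)).aestronglyMeasurable
    (Eventually.of_forall fun y => ?_)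
  rw [← add_sub_add_right_eq_sub y x₀ ξ]
  exact hC (y + ξ)

lemma integral_sub_ansatz (hν : 0 < ν) (hu : ur < ul) (hp : p ≠ 0)
    (h : IsPeriodicFront ν p ul ur x₀ u uL uR UL UR) (ht : 0 < t) (ξ : ℝ) :
    ∫ x, (u x t - ansatz uL uR (logisticFront ((ul - ur) / (2 * ν)) x₀) ξ x t)
      = excessMass ν ul ur x₀ UL UR ξ t := by
  obtain ⟨C, hC⟩ := h.exists_bound_gap hp ht (x₀ + ξ)
  obtain ⟨M, hM⟩ := (((h.periodic_left ht).sub (h.periodic_right ht)).isBounded_of_continuous hp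
    (h.continuous_sub ht)).exists_norm_le
  set β := (ul - ur) / (2 * ν)
  calc ∫ x, (u x t - ansatz uL uR (logisticFront β x₀) ξ x t)
      = ∫ x, (uL x t - uR x t)
          * (Real.sigmoid (-((UL x t - UR x t) / (2 * ν))) - logisticFront β (x₀ + ξ) x) := by
        congr with x
        rw [h.superposition x t ht, ansatz, logisticFront_sub]
        ring
    _ = ∫ x, (UL x t - UR x t - (ul - ur) * (x - (x₀ + ξ))) * deriv (logisticFront β (x₀ + ξ)) x :=
        integral_mul_sigmoid_div_sub_logisticFront (sub_pos.2 hu) (by positivity)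
          (h.hasDerivAt_gap ht) (h.continuous_sub ht) (fun x => hM _ (mem_range_self x)) hC
    _ = excessMass ν ul ur x₀ UL UR ξ t := by
        rw [← integral_add_right_eq_self _ ξ, excessMass]
        congr with y
        simp only [β, deriv_logisticFront, ← logisticFront_sub, add_sub_cancel_right,
          add_sub_add_right_eq_sub]

lemma excessMass_eq_of_mul_eq_nat_mul (hν : 0 < ν) (hu : ur < ul)
    (h : IsPeriodicFront ν p ul ur x₀ u uL uR UL UR) (ht : 0 ≤ t) {k : ℕ}
    (hk : (ul - ur) * t = k * p) (ξ : ℝ) :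
    excessMass ν ul ur x₀ UL UR ξ t = -((ul - ur) * (ξ - (ul + ur) / 2 * t)) := by
  have hgap : ∀ y, UL (y + ξ) t - UR (y + ξ) t - (ul - ur) * (y - x₀)
      = (ul - ur) * (ξ - (ul + ur) / 2 * t) := fun y => by
    rw [h.sub_eq_of_mul_eq_nat_mul ht hk]
    ring
  simp only [excessMass, hgap]
  rw [integral_const_mul, integral_deriv_logisticFront (div_pos (sub_pos.2 hu) (by positivity)),
    mul_neg_one]

end IsPeriodicFront

lemma norm_smul_fst_add_smul_snd_le {a b M N : ℝ} (ha : |a| ≤ M) (hb : |b| ≤ N) :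
    ‖a • ContinuousLinearMap.fst ℝ ℝ ℝ + b • ContinuousLinearMap.snd ℝ ℝ ℝ‖ ≤ M + N := by
  refine (norm_add_le _ _).trans (add_le_add ?_ ?_) <;> rw [norm_smul]
  · exact (mul_le_of_le_one_right (norm_nonneg _) (ContinuousLinearMap.norm_fst_le _ _ _)).trans ha
  · exact (mul_le_of_le_one_right (norm_nonneg _) (ContinuousLinearMap.norm_snd_le _ _ _)).trans hb

lemma hasFDerivAt_translate_sub_mul {D : ℝ → ℝ → ℝ} {d₁ d₂ y x τ : ℝ}
    (hD : HasFDerivAt (fun z : ℝ × ℝ => D z.1 z.2)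
      (d₁ • ContinuousLinearMap.fst ℝ ℝ ℝ + d₂ • ContinuousLinearMap.snd ℝ ℝ ℝ) (y + x, τ))
    (a c : ℝ) :
    HasFDerivAt (fun z : ℝ × ℝ => (D (y + z.1) z.2 - a) * c)
      ((d₁ * c) • ContinuousLinearMap.fst ℝ ℝ ℝ + (d₂ * c) • ContinuousLinearMap.snd ℝ ℝ ℝ)
      (x, τ) := by
  have htranslate : HasFDerivAt (fun z : ℝ × ℝ => (y + z.1, z.2))
      ((ContinuousLinearMap.fst ℝ ℝ ℝ).prod (ContinuousLinearMap.snd ℝ ℝ ℝ)) (x, τ) :=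
    (hasFDerivAt_fst.const_add y).prodMk hasFDerivAt_snd
  refine (((HasFDerivAt.comp (x, τ) hD htranslate).sub_const a).mul_const c).congr_fderiv ?_
  rw [ContinuousLinearMap.fst_prod_snd, ContinuousLinearMap.comp_id]
  module

lemma hasFDerivAt_integral_translate_sub_mul {D D₁ D₂ : ℝ → ℝ → ℝ} {l k : ℝ → ℝ}
    {ξ t t₁ t₂ M N : ℝ}
    (hD : ∀ x τ, 0 < τ → HasFDerivAt (fun z : ℝ × ℝ => D z.1 z.2)
      (D₁ x τ • ContinuousLinearMap.fst ℝ ℝ ℝ + D₂ x τ • ContinuousLinearMap.snd ℝ ℝ ℝ) (x, τ))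
    (hD₁ : Continuous fun x => D₁ x t) (hD₂ : Continuous fun x => D₂ x t)
    (hM : ∀ x, ∀ τ ∈ Icc t₁ t₂, |D₁ x τ| ≤ M) (hN : ∀ x, ∀ τ ∈ Icc t₁ t₂, |D₂ x τ| ≤ N)
    (ht₁ : 0 < t₁) (ht : t ∈ Ioo t₁ t₂) (hl : Continuous l) (hk : Integrable k)
    (hint : Integrable fun y => (D (y + ξ) t - l y) * k y) :
    HasFDerivAt (fun z : ℝ × ℝ => ∫ y, (D (y + z.1) z.2 - l y) * k y)
      ((∫ y, D₁ (y + ξ) t * k y) • ContinuousLinearMap.fst ℝ ℝ ℝ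
        + (∫ y, D₂ (y + ξ) t * k y) • ContinuousLinearMap.snd ℝ ℝ ℝ) (ξ, t) := by
  have hstrip : univ ×ˢ Icc t₁ t₂ ∈ 𝓝 (ξ, t) := prod_mem_nhds univ_mem (Icc_mem_nhds ht.1 ht.2)
  have hi₁ : Integrable fun y => D₁ (y + ξ) t * k y :=
    hk.bdd_mul (hD₁.comp (continuous_add_const ξ)).aestronglyMeasurable
      (Eventually.of_forall fun y => hM (y + ξ) t (Ioo_subset_Icc_self ht))
  have hi₂ : Integrable fun y => D₂ (y + ξ) t * k y :=
    hk.bdd_mul (hD₂.comp (continuous_add_const ξ)).aestronglyMeasurable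
      (Eventually.of_forall fun y => hN (y + ξ) t (Ioo_subset_Icc_self ht))
  have hi₁' := hi₁.smul_const (ContinuousLinearMap.fst ℝ ℝ ℝ)
  have hi₂' := hi₂.smul_const (ContinuousLinearMap.snd ℝ ℝ ℝ)
  refine HasFDerivAt.congr_fderiv ?_ ((integral_add hi₁' hi₂').trans
    (congrArg₂ (· + ·) (integral_smul_const _ _) (integral_smul_const _ _)))
  refine hasFDerivAt_integral_of_dominated_of_fderiv_le (𝕜 := ℝ)
    (F := fun z y => (D (y + z.1) z.2 - l y) * k y)
    (F' := fun z y => (D₁ (y + z.1) z.2 * k y) • ContinuousLinearMap.fst ℝ ℝ ℝ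
      + (D₂ (y + z.1) z.2 * k y) • ContinuousLinearMap.snd ℝ ℝ ℝ)
    (bound := fun y => M * |k y| + N * |k y|) hstrip ?_ hint ?_
    (Eventually.of_forall fun y z hz => ?_) ?_ (Eventually.of_forall fun y z hz => ?_)
  · filter_upwards [hstrip] with z hz
    have hDz : Continuous fun x => D x z.2 := continuous_iff_continuousAt.2 fun x =>
      (hasDerivAt_slice_fst (hD x z.2 (ht₁.trans_le hz.2.1)).differentiableAt).continuousAt
    exact ((hDz.comp (continuous_add_const z.1)).sub hl).aestronglyMeasurable.mul hk.1
  · exact (hi₁'.add hi₂').aestronglyMeasurable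
  · refine norm_smul_fst_add_smul_snd_le ?_ ?_ <;> rw [abs_mul] <;> gcongr
    exacts [hM _ _ hz.2, hN _ _ hz.2]
  · exact (hk.abs.const_mul M).add (hk.abs.const_mul N)
  · exact hasFDerivAt_translate_sub_mul (hD _ _ (ht₁.trans_le hz.2.1)) (l y) (k y)

namespace IsPeriodicFront

variable {ν p ul ur x₀ t : ℝ} {u uL uR UL UR : ℝ → ℝ → ℝ}

lemma continuousOn_sub (h : IsPeriodicFront ν p ul ur x₀ u uL uR UL UR) :
    ContinuousOn (fun z : ℝ × ℝ => uL z.1 z.2 - uR z.1 z.2) {z : ℝ × ℝ | 0 < z.2} :=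
  h.potential_left.smooth.continuousOn.sub h.potential_right.smooth.continuousOn

lemma continuousOn_burgersRate_sub (h : IsPeriodicFront ν p ul ur x₀ u uL uR UL UR) :
    ContinuousOn (fun z : ℝ × ℝ => burgersRate ν uL z.1 z.2 - burgersRate ν uR z.1 z.2)
      {z : ℝ × ℝ | 0 < z.2} :=
  (continuousOn_burgersRate ν h.potential_left.smooth).sub
    (continuousOn_burgersRate ν h.potential_right.smooth)

lemma periodic_burgersRate_sub (h : IsPeriodicFront ν p ul ur x₀ u uL uR UL UR) (ht : 0 < t) :
    Function.Periodic (fun x => burgersRate ν uL x t - burgersRate ν uR x t) p :=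
  (burgersRate_periodic (h.periodic_left ht)).sub (burgersRate_periodic (h.periodic_right ht))

lemma hasFDerivAt_excessMass (hν : 0 < ν) (hu : ur < ul) (hp : 0 < p)
    (h : IsPeriodicFront ν p ul ur x₀ u uL uR UL UR) (ht : 0 < t) (ξ : ℝ) :
    HasFDerivAt (fun z : ℝ × ℝ => excessMass ν ul ur x₀ UL UR z.1 z.2)
      ((∫ x, (uL x t - uR x t) * deriv (logisticFront ((ul - ur) / (2 * ν)) x₀) (x - ξ))
          • ContinuousLinearMap.fst ℝ ℝ ℝ
        + (∫ x, (burgersRate ν uL x t - burgersRate ν uR x t)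
            * deriv (logisticFront ((ul - ur) / (2 * ν)) x₀) (x - ξ))
          • ContinuousLinearMap.snd ℝ ℝ ℝ) (ξ, t) := by
  obtain ⟨M, hM⟩ := exists_bound_of_periodic (f := fun x t => uL x t - uR x t) hp
    h.continuousOn_sub (fun t ht => (h.periodic_left ht).sub (h.periodic_right ht))
    (half_pos ht) (2 * t)
  obtain ⟨N, hN⟩ := exists_bound_of_periodic
    (f := fun x t => burgersRate ν uL x t - burgersRate ν uR x t) hp
    h.continuousOn_burgersRate_sub (fun t ht => h.periodic_burgersRate_sub ht)
    (half_pos ht) (2 * t)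
  rw [← integral_add_right_eq_self (fun x => (uL x t - uR x t) * _) ξ,
    ← integral_add_right_eq_self (fun x => (burgersRate ν uL x t - burgersRate ν uR x t) * _) ξ]
  simp only [add_sub_cancel_right]
  exact hasFDerivAt_integral_translate_sub_mul (D := fun x t => UL x t - UR x t)
    (fun x τ hτ => h.potential_left.hasFDerivAt_sub h.potential_right hτ)
    (h.continuous_sub ht)
    (continuous_slice_fst (f := fun x t => burgersRate ν uL x t - burgersRate ν uR x t)
      h.continuousOn_burgersRate_sub ht)
    hM hN (half_pos ht) ⟨half_lt_self ht, by linarith⟩ (by fun_prop)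
    (integrable_deriv_logisticFront (div_pos (sub_pos.2 hu) (by positivity)))
    (h.integrable_excessMass hν hu hp.ne' ht ξ)

end IsPeriodicFront

section PeriodicIntegrals

variable {v k g : ℝ → ℝ} {p : ℝ}

lemma integrable_periodic_mul_comp_sub (hp : p ≠ 0) (hv : Continuous v)
    (hper : Function.Periodic v p) (hk : Integrable k) (ξ : ℝ) :
    Integrable fun x => v x * k (x - ξ) := by
  obtain ⟨C, hC⟩ := (hper.isBounded_of_continuous hp hv).exists_norm_le
  exact (hk.comp_sub_right ξ).bdd_mul hv.aestronglyMeasurable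
    (Eventually.of_forall fun x => hC _ (mem_range_self x))

lemma integral_periodic_mul_iteratedDeriv_two_comp_sub (hp : p ≠ 0) (hv : ContDiff ℝ 1 v)
    (hper : Function.Periodic v p) (hg : ∀ x, HasDerivAt (deriv g) (iteratedDeriv 2 g x) x)
    (hg₁ : Integrable (deriv g)) (hg₂ : Integrable (iteratedDeriv 2 g)) (ξ : ℝ) :
    ∫ x, v x * iteratedDeriv 2 g (x - ξ) = -∫ x, deriv v x * deriv g (x - ξ) :=
  integral_mul_deriv_eq_deriv_mul_of_integrable
    (fun x _ => (hv.differentiable one_ne_zero x).hasDerivAt)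
    (fun x _ => (hg (x - ξ)).comp_sub_const x ξ)
    (integrable_periodic_mul_comp_sub hp hv.continuous hper hg₂ ξ)
    (integrable_periodic_mul_comp_sub hp (hv.continuous_deriv le_rfl) (periodic_deriv hper) hg₁ ξ)
    (integrable_periodic_mul_comp_sub hp hv.continuous hper hg₁ ξ)

lemma shiftField_mul_integral {ν t ξ : ℝ} {uL uR : ℝ → ℝ → ℝ} (hp : p ≠ 0)
    (hL : ContDiff ℝ 1 fun x => uL x t) (hR : ContDiff ℝ 1 fun x => uR x t)
    (hLper : Function.Periodic (fun x => uL x t) p) (hRper : Function.Periodic (fun x => uR x t) p)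
    (hg : ∀ x, HasDerivAt (deriv g) (iteratedDeriv 2 g x) x)
    (hg₁ : Integrable (deriv g)) (hg₂ : Integrable (iteratedDeriv 2 g))
    (hmass : ∫ x, (uL x t - uR x t) * deriv g (x - ξ) ≠ 0) :
    shiftField burgersFlux ν uL uR g ξ t * ∫ x, (uL x t - uR x t) * deriv g (x - ξ)
      = -∫ x, (burgersRate ν uL x t - burgersRate ν uR x t) * deriv g (x - ξ) := by
  have hsub : ContDiff ℝ 1 fun x => uL x t - uR x t := hL.sub hR
  have hsub_per : Function.Periodic (fun x => uL x t - uR x t) p := hLper.sub hRper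
  have hderiv : deriv (fun x => uL x t - uR x t)
      = fun x => deriv (fun y => uL y t) x - deriv (fun y => uR y t) x := funext fun x =>
    deriv_fun_sub (hL.differentiable one_ne_zero x) (hR.differentiable one_ne_zero x)
  have hflux : Continuous fun x => burgersFlux (uL x t) - burgersFlux (uR x t) := by
    unfold burgersFlux
    fun_prop
  have hint_flux : Integrable fun x =>
      (burgersFlux (uL x t) - burgersFlux (uR x t)) * deriv g (x - ξ) :=
    integrable_periodic_mul_comp_sub hp hflux
      ((hLper.comp burgersFlux).sub (hRper.comp burgersFlux)) hg₁ ξ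
  have hint_deriv := (integrable_periodic_mul_comp_sub hp (hsub.continuous_deriv le_rfl)
    (periodic_deriv hsub_per) hg₁ ξ).const_mul ν
  have hint_two := (integrable_periodic_mul_comp_sub hp hsub.continuous hsub_per hg₂ ξ).const_mul ν
  calc shiftField burgersFlux ν uL uR g ξ t * ∫ x, (uL x t - uR x t) * deriv g (x - ξ)
      = ∫ x, (ν * ((uL x t - uR x t) * iteratedDeriv 2 g (x - ξ))
          + (burgersFlux (uL x t) - burgersFlux (uR x t)) * deriv g (x - ξ)) := by
        simp only [shiftField, div_mul_cancel₀ _ hmass, mul_assoc]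
    _ = -(ν * ∫ x, deriv (fun x => uL x t - uR x t) x * deriv g (x - ξ))
          + ∫ x, (burgersFlux (uL x t) - burgersFlux (uR x t)) * deriv g (x - ξ) := by
        rw [integral_add hint_two hint_flux, integral_const_mul,
          integral_periodic_mul_iteratedDeriv_two_comp_sub hp hsub hsub_per hg hg₁ hg₂, mul_neg]
    _ = -∫ x, (burgersRate ν uL x t - burgersRate ν uR x t) * deriv g (x - ξ) := by
        rw [← integral_const_mul, neg_add_eq_sub, ← neg_sub, ← integral_sub hint_deriv hint_flux]
        congr with x
        rw [hderiv, burgersRate, burgersRate, burgersFlux, burgersFlux]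
        ring

end PeriodicIntegrals

lemma integral_mul_deriv_logisticFront_neg {v : ℝ → ℝ} {β x₀ ξ m : ℝ} (hβ : 0 < β) (hm : 0 < m)
    (hv : ∀ x, m ≤ v x) (hint : Integrable fun x => v x * deriv (logisticFront β x₀) (x - ξ)) :
    ∫ x, v x * deriv (logisticFront β x₀) (x - ξ) < 0 := by
  calc ∫ x, v x * deriv (logisticFront β x₀) (x - ξ)
      ≤ ∫ x, m * deriv (logisticFront β x₀) (x - ξ) :=
        integral_mono hint (((integrable_deriv_logisticFront hβ).comp_sub_right ξ).const_mul m)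
          fun x => mul_le_mul_of_nonpos_right (hv x) (deriv_logisticFront_neg hβ _).le
    _ = -m := by
        rw [integral_const_mul, integral_sub_right_eq_self, integral_deriv_logisticFront hβ,
          mul_neg_one]
    _ < 0 := neg_lt_zero.2 hm

namespace IsPeriodicFront

variable {ν p ul ur x₀ T₀ t : ℝ} {X : ℝ → ℝ} {u uL uR UL UR : ℝ → ℝ → ℝ}

lemma hasDerivAt_excessMass_shift (hν : 0 < ν) (hu : ur < ul) (hp : 0 < p)
    (h : IsPeriodicFront ν p ul ur x₀ u uL uR UL UR) (ht : 0 < t)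
    (hgap : ∀ x, (ul - ur) / 2 < uL x t - uR x t)
    (hX : HasDerivAt X (shiftField burgersFlux ν uL uR
      (logisticFront ((ul - ur) / (2 * ν)) x₀) (X t) t) t) :
    HasDerivAt (fun τ => excessMass ν ul ur x₀ UL UR (X τ) τ) 0 t := by
  have hβ : 0 < (ul - ur) / (2 * ν) := div_pos (sub_pos.2 hu) (by positivity)
  have hmass := integral_mul_deriv_logisticFront_neg hβ (half_pos (sub_pos.2 hu))
    (fun x => (hgap x).le) (integrable_periodic_mul_comp_sub hp.ne' (h.continuous_sub ht)
      ((h.periodic_left ht).sub (h.periodic_right ht))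
      (integrable_deriv_logisticFront (x₀ := x₀) hβ) (X t))
  have hfield := shiftField_mul_integral (ν := ν) hp.ne'
    (contDiff_slice_fst (h.potential_left.smooth.of_le (by simp)) ht)
    (contDiff_slice_fst (h.potential_right.smooth.of_le (by simp)) ht)
    (h.periodic_left ht) (h.periodic_right ht) hasDerivAt_deriv_logisticFront
    (integrable_deriv_logisticFront hβ) (integrable_iteratedDeriv_two_logisticFront hβ) hmass.ne
  refine (HasFDerivAt.comp_hasDerivAt (f := fun τ => (X τ, τ)) t
    (h.hasFDerivAt_excessMass hν hu hp ht (X t))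
    (hX.prodMk (hasDerivAt_id t))).congr_deriv ?_
  simp only [add_apply, smul_apply,
    ContinuousLinearMap.coe_fst', ContinuousLinearMap.coe_snd', smul_eq_mul, mul_one]
  rw [mul_comm, hfield, neg_add_cancel]

lemma continuousOn_excessMass_shift (hν : 0 < ν) (hu : ur < ul) (hp : 0 < p)
    (h : IsPeriodicFront ν p ul ur x₀ u uL uR UL UR) (hT₀ : 0 < T₀) (hX : ContinuousOn X (Ici T₀)) :
    ContinuousOn (fun τ => excessMass ν ul ur x₀ UL UR (X τ) τ) (Ici T₀) := fun τ hτ =>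
  ContinuousAt.comp_continuousWithinAt (f := fun τ => (X τ, τ))
    (g := fun z : ℝ × ℝ => excessMass ν ul ur x₀ UL UR z.1 z.2)
    (h.hasFDerivAt_excessMass hν hu hp (hT₀.trans_le hτ) (X τ)).continuousAt
    ((hX τ hτ).prodMk continuousWithinAt_id)

lemma excessMass_shift_eq_zero (hν : 0 < ν) (hu : ur < ul) (hp : 0 < p)
    (h : IsPeriodicFront ν p ul ur x₀ u uL uR UL UR) (hT : IsAdmissibleTime ul ur uL uR T₀)
    (hX : IsShiftFunction burgersFlux ν u uL uR (logisticFront ((ul - ur) / (2 * ν)) x₀) T₀ X)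
    (ht : T₀ ≤ t) : excessMass ν ul ur x₀ UL UR (X t) t = 0 := by
  obtain ⟨hT₀, hgap⟩ := hT
  have hinitial : excessMass ν ul ur x₀ UL UR (X T₀) T₀ = 0 := by
    rw [← h.integral_sub_ansatz hν hu hp.ne' hT₀, hX.zero_mass]
  rcases ht.eq_or_lt with rfl | hlt
  · exact hinitial
  obtain ⟨τ, -, hslope⟩ := exists_hasDerivAt_eq_slope
    (fun t => excessMass ν ul ur x₀ UL UR (X t) t) (fun _ => 0) hlt
    ((h.continuousOn_excessMass_shift hν hu hp hT₀ hX.continuousOn).mono Icc_subset_Ici_self)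
    fun τ hτ => h.hasDerivAt_excessMass_shift hν hu hp (hT₀.trans hτ.1)
      (fun x => (hgap x τ hτ.1.le).1) (hX.equation τ hτ.1)
  rw [eq_div_iff (sub_ne_zero.2 hlt.ne'), zero_mul, hinitial, sub_zero] at hslope
  exact hslope.symm

theorem shift_eq_of_mul_eq_nat_mul (hν : 0 < ν) (hu : ur < ul) (hp : 0 < p)
    (h : IsPeriodicFront ν p ul ur x₀ u uL uR UL UR) (hT : IsAdmissibleTime ul ur uL uR T₀)
    (hX : IsShiftFunction burgersFlux ν u uL uR (logisticFront ((ul - ur) / (2 * ν)) x₀) T₀ X)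
    (ht : T₀ ≤ t) {k : ℕ} (hk : (ul - ur) * t = k * p) : X t = (ul + ur) / 2 * t := by
  have hzero := h.excessMass_shift_eq_zero hν hu hp hT hX ht
  rw [h.excessMass_eq_of_mul_eq_nat_mul hν hu (hT.1.trans_le ht).le hk, neg_eq_zero] at hzero
  exact sub_eq_zero.1 ((mul_eq_zero.1 hzero).resolve_left (sub_pos.2 hu).ne')

end IsPeriodicFront

end ViscousLaw

theorem mainTheorem5 (ν ul ur p : ℝ) (hν : 0 < ν) (hu : ur < ul) (hp : 0 < p)
    (φ : ℝ → ℝ) (hφ : ViscousLaw.IsShockProfile ViscousLaw.burgersFlux 1 ul ur φ)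
    (w₀ : ℝ → ℝ) (hw : MemLp w₀ ⊤ volume) (hper : Function.Periodic w₀ p)
    (havg : (1 / p) * ∫ x in (0 : ℝ)..p, w₀ x = 0)
    (u uL uR : ℝ → ℝ → ℝ)
    (hsol : ViscousLaw.IsBoundedSolution ViscousLaw.burgersFlux ν
      (fun x => ViscousLaw.scaledProfile φ ν x + w₀ x) u)
    (hL : ViscousLaw.IsBoundedSolution ViscousLaw.burgersFlux ν (fun x => ul + w₀ x) uL)
    (hR : ViscousLaw.IsBoundedSolution ViscousLaw.burgersFlux ν (fun x => ur + w₀ x) uR) :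
    (∀ k : ℕ, ∀ x : ℝ,
      u x (k * p / (ul - ur)) =
        ViscousLaw.ansatz uL uR (ViscousLaw.weight φ ν ul ur)
          (ViscousLaw.shockSpeed ViscousLaw.burgersFlux ul ur * (k * p / (ul - ur)))
          x (k * p / (ul - ur))) ∧
    (∀ (T₀ : ℝ) (X : ℝ → ℝ),
      ViscousLaw.IsAdmissibleTime ul ur uL uR T₀ →
      ViscousLaw.IsShiftFunction ViscousLaw.burgersFlux ν u uL uR
        (ViscousLaw.weight φ ν ul ur) T₀ X →
      ∀ k : ℕ, T₀ ≤ k * p / (ul - ur) →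
        X (k * p / (ul - ur)) =
          ViscousLaw.shockSpeed ViscousLaw.burgersFlux ul ur * (k * p / (ul - ur))) := by
  have hc : 0 < ul - ur := sub_pos.2 hu
  have havg' : ∫ x in (0 : ℝ)..p, w₀ x = 0 :=
    (mul_eq_zero.1 havg).resolve_left (one_div_ne_zero hp.ne')
  obtain ⟨x₀, hweight⟩ := hφ.exists_weight_eq_sigmoid hν.ne' hu
  replace hweight : ViscousLaw.weight φ ν ul ur
      = ViscousLaw.logisticFront ((ul - ur) / (2 * ν)) x₀ := funext hweight
  have hprofile : ∀ x, ViscousLaw.scaledProfile φ ν x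
      = ur + (ul - ur) * ViscousLaw.logisticFront ((ul - ur) / (2 * ν)) x₀ x := fun x => by
    rw [← hweight, ViscousLaw.weight, mul_div_cancel₀ _ hc.ne', add_sub_cancel]
  simp only [hprofile] at hsol
  obtain ⟨UL, UR, h⟩ := ViscousLaw.exists_isPeriodicFront hν hw hper havg' hsol hL hR
  have hk : ∀ k : ℕ, (ul - ur) * (k * p / (ul - ur)) = k * p := fun k =>
    mul_div_cancel₀ _ hc.ne'
  rw [hweight, ViscousLaw.shockSpeed_burgersFlux hu.ne']
  refine ⟨fun k x => ?_, fun T₀ X hT hX k ht =>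
    h.shift_eq_of_mul_eq_nat_mul hν hu hp hT hX ht (hk k)⟩
  rcases k.eq_zero_or_pos with rfl | hk_pos
  · simp only [Nat.cast_zero, zero_mul, zero_div, mul_zero, ViscousLaw.ansatz, sub_zero,
      hsol.initial_value, hL.initial_value, hR.initial_value]
    ring
  · exact h.eq_ansatz_of_mul_eq_nat_mul (by positivity) (hk k)
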